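/- Let $S^7\subset\mathbb R^8$ be the unit sphere with its usual Riemannian metric and surface measure, let $X_1(x)=-x_1\partial_{x_0}+x_0\partial_{x_1}-x_3\partial_{x_2}+x_2\partial_{x_3}-x_5\partial_{x_4}+x_4\partial_{x_5}-x_7\partial_{x_6}+x_6\partial_{x_7}$ be the Hopf vector field, let $\mathcal H=X_1^\perp\subset TS^7$ be the contact distribution with the restricted metric, and let $\mu$ be the Riemannian volume form, which is up to a constant factor Popp's volume form of $(S^7,\mathcal H)$. Define the divergence by $L_Y\mu=(\operatorname{div}Y)\mu$. Let $\Delta_{S^7}f=\operatorname{div}(\nabla f)$ be the Laplace–Beltrami operator and $\Delta_{sR}f=\operatorname{div}(\nabla_{sR}f)$ the intrinsic sub-Laplacian, where $\nabla_{sR}f\in\mathcal H$ satisfies $\langle\nabla_{sR}f,v\rangle=df(v)$ for all $v\in\mathcal H$. On complex-valued functions these operators are extended $\mathbb C$-linearly. Then $$\Delta_{S^7}f=\Delta_{sR}f+X_1^2f\qquad\text{for all } f\in C^\infty(S^7).$$ For each $A\in\{\Delta_{S^7},\Delta_{sR},X_1^2\}$ there is a unique strongly continuous semigroup $(e^{tA})_{t\ge0}$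 of bounded operators on $L^2(S^7)$ (real or complex) whose infinitesimal generator is the closure of $A$ with domain $C^\infty(S^7)$; it is the heat semigroup of $A$, which is also often written $e^{-tA}$, $t\ge 0$. Each $e^{tA}$ is injective with dense range. For $t>0$ let $e^{-tA}$ here denote the densely defined inverse of $e^{tA}$, so that $e^{sA}$ is defined for all $s\in\mathbb R$. Products of unbounded operators carry their natural domains. Then: 1. The semigroup of $\Delta_{S^7}$ is also that of $\Delta_{sR}+X_1^2$, and the heat semigroups factor: $$e^{t\Delta_{S^7}}=e^{t(\Delta_{sR}+X_1^2)}=e^{t\Delta_{sR}}\,e^{tX_1^2}\qquad(t\ge0).$$ More generally $e^{s\Delta_{S^7}}=e^{s\Delta_{sR}}e^{sX_1^2}$ for all $s\in\mathbb R$, with equality of domains. 2. For $s\ge0$, $e^{s\Delta_{sR}}$ is the closure of the densely defined operator $e^{s\Delta_{S^7}}e^{-sX_1^2}$, and in the other order $e^{s\Delta_{sR}}=e^{-sX_1^2}e^{s\Delta_{S^7}}$ holds exactly on all of $L^2(S^7)$. For $s\le0$, $e^{s\Delta_{sR}}=e^{s\Delta_{S^7}}e^{-sX_1^2}$ holds with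 equality of domains. -/

import Mathlib

open MeasureTheory Filter Topology Metric Module
open scoped NNReal ENNReal Manifold ContDiff RealInnerProductSpace

noncomputable section

/-! ### One-parameter semigroups and their generators

Unbounded operators on a normed space `H` are represented by their graphs, as subsets of `H × H`. -/

/-- A strongly continuous one-parameter semigroup `(T_t)_{t ≥ 0}` of bounded operators on `H`. -/
structure C0Semigroup (𝕜 H : Type*) [RCLike 𝕜] [NormedAddCommGroup H] [NormedSpace 𝕜 H] where
  op : ℝ≥0 → H →L[𝕜] H
  op_zero : op 0 = ContinuousLinearMap.id 𝕜 H
  op_add : ∀ s t : ℝ≥0, op (s + t) = (op s).comp (op t)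
  op_continuous : ∀ u : H, Continuous fun t => op t u

namespace C0Semigroup

variable {𝕜 H : Type*} [RCLike 𝕜] [NormedAddCommGroup H] [NormedSpace 𝕜 H]

/-- The graph of the infinitesimal generator: the pairs `(u, v)` such that
`(T_t u - u) / t → v` in `H` as `t → 0+`. -/
def generator (T : C0Semigroup 𝕜 H) : Set (H × H) :=
  {z | Tendsto (fun t : ℝ≥0 => (((t : ℝ)⁻¹ : ℝ) : 𝕜) • (T.op t z.1 - z.1)) (𝓝[>] 0) (𝓝 z.2)}

/-- The graph of `e^{sA}` for all real `s`, where `A` is the generator of `T`: the operator `T_s`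
if `s ≥ 0`, and the inverse of `T_{-s}`, with domain the range of `T_{-s}`, if `s < 0`. -/
def exp (T : C0Semigroup 𝕜 H) (s : ℝ) : Set (H × H) :=
  if 0 ≤ s then {z | z.2 = T.op s.toNNReal z.1} else {z | z.1 = T.op (-s).toNNReal z.2}

end C0Semigroup

/-- The graph of the composition `B A` (first `A`, then `B`) of two unbounded operators, with its
natural domain `{u ∈ dom A | A u ∈ dom B}`. -/
def opComp {H : Type*} (B A : Set (H × H)) : Set (H × H) :=
  {z | ∃ v, (z.1, v) ∈ A ∧ (v, z.2) ∈ B}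

/-! ### The sphere `S^7` and calculus on it -/

/-- The Euclidean space `ℝ^8`. -/
abbrev E8 : Type := EuclideanSpace ℝ (Fin 8)

/-- The unit sphere of `ℝ^8`. -/
abbrev S7 : Type := sphere (0 : E8) 1

instance factFinrankE8 : Fact (finrank ℝ E8 = 7 + 1) := ⟨by simp⟩

/-- The surface measure of `S^7`. -/
abbrev sphereMeasure : Measure S7 := (volume : Measure E8).toSphere

/-- The Hilbert space `L^2(S^7)` of real or complex functions. -/
abbrev L2S7 (𝕜 : Type*) [RCLike 𝕜] : Type _ := Lp 𝕜 2 sphereMeasure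

/-- The extension of a function on `S^7` to `ℝ^8 ∖ {0}` that is constant along rays. -/
def radialExt {F : Type*} [Zero F] (f : S7 → F) (x : E8) : F :=
  open Classical in
  if hx : x = 0 then 0
  else f ⟨‖x‖⁻¹ • x, by simp [norm_smul, hx]⟩

/-- The differential `d_p f` of a function on `S^7` with values in a normed space. On vectors
tangent to the sphere at `p` it is the differential of `f`; on the normal line it vanishes. -/
def sphereD {F : Type*} [NormedAddCommGroup F] [NormedSpace ℝ F] (f : S7 → F) (p : S7) :
    E8 →L[ℝ] F :=
  fderiv ℝ (radialExt f) (p : E8)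

/-- The orthonormal frame `X_1, …, X_7` of `T S^7` given by octonion multiplication
(`frame 0` is `X_1`, and so on). -/
def frame : Fin 7 → E8 → E8 :=
  ![fun x => !₂[-x 1, x 0, -x 3, x 2, -x 5, x 4, -x 7, x 6],
    fun x => !₂[-x 2, x 3, x 0, -x 1, -x 6, x 7, x 4, -x 5],
    fun x => !₂[-x 3, -x 2, x 1, x 0, x 7, x 6, -x 5, -x 4],
    fun x => !₂[-x 4, x 5, x 6, -x 7, x 0, -x 1, -x 2, x 3],
    fun x => !₂[-x 5, -x 4, -x 7, -x 6, x 1, x 0, x 3, x 2],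
    fun x => !₂[-x 6, x 7, -x 4, x 5, x 2, -x 3, x 0, -x 1],
    fun x => !₂[-x 7, -x 6, x 5, x 4, -x 3, -x 2, x 1, x 0]]

/-- The tangent space `T_p S^7`, as a subspace of `ℝ^8`. -/
def tangentS7 (p : S7) : Submodule ℝ E8 := (Submodule.span ℝ {(p : E8)})ᗮ

/-- The contact distribution of `S^7`: the orthogonal complement in `T_p S^7` of the Hopf vector
field `X_1`. -/
def contactDist (p : S7) : Submodule ℝ E8 := (Submodule.span ℝ {(p : E8), frame 0 p})ᗮ

/-- The gradient of `f` along a distribution `D`, with the metric restricted from `ℝ^8`: the vector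
`∇f(p) ∈ D_p` such that `⟪∇f(p), v⟫ = d_p f(v)` for all `v ∈ D_p`. -/
def gradAlong (D : S7 → Submodule ℝ E8) (f : S7 → ℝ) (p : S7) : E8 :=
  ((InnerProductSpace.toDual ℝ (D p)).symm ((sphereD f p).comp (D p).subtypeL) : D p)

/-- The volume form `dX_1 ∧ … ∧ dX_7` of `S^7`, with `dX_j = ⟪X_j, ·⟫` the dual coframe. It is both
the Riemannian volume form and (up to a constant factor) Popp's volume form of the contact
sub-Riemannian structure. -/
def volForm (p : S7) (v : Fin 7 → E8) : ℝ :=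
  Matrix.det (Matrix.of fun i j : Fin 7 => ⟪frame j p, v i⟫)

/-- The Lie derivative `(L_Y μ)_p(v_1, …, v_7)` of the volume form along the tangent vector field
`Y`, by the coordinate formula
`(L_Y μ)(v_1, …) = (Y μ)(v_1, …) + ∑_i μ(v_1, …, DY(v_i), …)` in `ℝ^8`. -/
def lieDerivVol (Y : S7 → E8) (p : S7) (v : Fin 7 → E8) : ℝ :=
  sphereD (fun q => volForm q v) p (Y p) +
    ∑ i, volForm p (Function.update v i (sphereD Y p (v i)))

/-- The divergence of a tangent vector field `Y`, defined by `L_Y μ = (div Y) μ`; both 7-forms are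
evaluated on the frame `X_1, …, X_7` at `p`. -/
def divergence (Y : S7 → E8) (p : S7) : ℝ :=
  lieDerivVol Y p (fun i => frame i p) / volForm p (fun i => frame i p)

/-- The Laplace–Beltrami operator `Δ_{S^7} f = div (∇ f)`. -/
def laplaceBeltrami (f : S7 → ℝ) : S7 → ℝ := divergence (gradAlong tangentS7 f)

/-- The intrinsic sub-Laplacian `Δ_{sR} f = div (∇_{sR} f)` of the contact distribution. -/
def subLaplacian (f : S7 → ℝ) : S7 → ℝ := divergence (gradAlong contactDist f)

/-- The operator `f ↦ X_1 f`. -/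
def hopfDeriv (f : S7 → ℝ) (p : S7) : ℝ := sphereD f p (frame 0 p)

/-- The operator `f ↦ X_1^2 f`. -/
def hopfSq (f : S7 → ℝ) : S7 → ℝ := hopfDeriv (hopfDeriv f)

/-! ### Differential operators on `L^2(S^7)` -/

/-- The `𝕜`-linear extension of an operator on real functions to real or complex functions. -/
def extendScalars (𝕜 : Type*) [RCLike 𝕜] (D : (S7 → ℝ) → S7 → ℝ) (f : S7 → 𝕜) (p : S7) : 𝕜 :=
  (D (fun q => RCLike.re (f q)) p : 𝕜) + RCLike.I * (D (fun q => RCLike.im (f q)) p : 𝕜)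

/-- The graph in `L^2 × L^2` of the differential operator `D` with domain `C^∞(S^7)`. -/
def smoothGraph (𝕜 : Type*) [RCLike 𝕜] (D : (S7 → ℝ) → S7 → ℝ) : Set (L2S7 𝕜 × L2S7 𝕜) :=
  {z | ∃ f : S7 → 𝕜, ContMDiff (𝓡 7) 𝓘(ℝ, 𝕜) ∞ f ∧
    z.1 =ᵐ[sphereMeasure] f ∧ z.2 =ᵐ[sphereMeasure] extendScalars 𝕜 D f}

/-- `T` is the semigroup on `L^2(S^7)` whose infinitesimal generator is the differential operator
`D`, that is, the closure of `D` with domain `C^∞(S^7)`. -/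
def IsHeatSemigroup {𝕜 : Type*} [RCLike 𝕜] (D : (S7 → ℝ) → S7 → ℝ)
    (T : C0Semigroup 𝕜 (L2S7 𝕜)) : Prop :=
  T.generator = closure (smoothGraph 𝕜 D)

end

/-! All three operators are diagonal in one Hilbert basis of $L^2(S^7)$, with eigenvalues that add
up; every assertion about semigroups is then read off coordinate by coordinate.

The octonionic frame consists of linear fields given by skew, orthogonal matrices. It is orthonormal
and divergence free, so $\Delta_{S^7}$, $\Delta_{sR}$ and $X_1^2$ are $\sum_j c_jX_j^2$ with
$c_j\in\{0,1\}$ (`laplaceBeltrami_eq_sumSq`, `subLaplacian_eq_sumSq`, `hopfSq_eq_sumSq`), and the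
decomposition of the Laplacian is immediate. The flow of each $X_j$ preserves the surface measure.
Integration by parts (`integral_mul_frameDeriv`) therefore makes these operators symmetric and
nonpositive.

Since the flow of $X_1$ acts by isometries, $X_1$ commutes with $\Delta_{S^7}$ and hence with
$\Delta_{S^7}-X_1^2=\Delta_{sR}$. Here this is verified algebraically on polynomials
(`commute_polySumSq`). Linear fields do not raise the degree, so the polynomials of bounded degree
restrict to finite-dimensional invariant spaces, where commuting symmetric operators have joint
eigenvectors (`map_mem_span_joint_eigenvectors`). By Stone–Weierstrass these eigenvectors are total
in $L^2$.

A symmetric operator with a total set of eigenvectors in its domain is essentially self-adjoint: its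
closure is the maximal diagonal operator (`exists_joint_hilbertBasis`). Its semigroup has
coordinates $e^{-t\lambda_i}$, and an ODE argument on eigenvectors gives uniqueness. As
$\lambda^{\Delta}_i=\lambda^{sR}_i+\lambda^{X_1^2}_i$, the semigroups factor and commute. The
statements about inverses follow formally from this together with injectivity and dense range of the
factors. -/

/-! ### Diagonal semigroups -/

section Diagonal

variable {𝕜 H ι : Type*} [RCLike 𝕜] [NormedAddCommGroup H] [InnerProductSpace 𝕜 H]

/-- The graph of the operator, with maximal domain, that multiplies the coordinates in the Hilbert
basis `b` by `a`. -/
def diagGraph (b : HilbertBasis ι 𝕜 H) (a : ι → ℝ) : Set (H × H) :=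
  {z | ∀ i, inner 𝕜 (b i) z.2 = (a i : 𝕜) * inner 𝕜 (b i) z.1}

theorem HilbertBasis.hasSum_norm_sq (b : HilbertBasis ι 𝕜 H) (u : H) :
    HasSum (fun i => ‖(inner 𝕜 (b i) u : 𝕜)‖ ^ 2) (‖u‖ ^ 2) := by
  have h := lp.hasSum_norm (p := 2) (by norm_num) (b.repr u)
  simpa [b.repr_apply_apply] using h

theorem HilbertBasis.ext_inner (b : HilbertBasis ι 𝕜 H) {u v : H}
    (h : ∀ i, inner 𝕜 (b i) u = inner 𝕜 (b i) v) : u = v :=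
  b.repr.injective (lp.ext (funext fun i => by simp only [b.repr_apply_apply, h]))

theorem HilbertBasis.inner_basis [DecidableEq ι] (b : HilbertBasis ι 𝕜 H) (i j : ι) :
    inner 𝕜 (b i) (b j) = if i = j then (1 : 𝕜) else 0 :=
  orthonormal_iff_ite.1 b.orthonormal i j

theorem HilbertBasis.exists_diagonal_clm (b : HilbertBasis ι 𝕜 H) (a : ι → ℝ)
    (ha : ∀ i, |a i| ≤ 1) :
    ∃ T : H →L[𝕜] H, ∀ u i, inner 𝕜 (b i) (T u) = (a i : 𝕜) * inner 𝕜 (b i) u := by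
  have hle : ∀ (u : H) i, ‖(a i : 𝕜) * inner 𝕜 (b i) u‖ ≤ ‖(inner 𝕜 (b i) u : 𝕜)‖ := fun u i => by
    rw [norm_mul, RCLike.norm_ofReal]
    exact mul_le_of_le_one_left (norm_nonneg _) (ha i)
  have hmem : ∀ u : H, Memℓp (fun i => (a i : 𝕜) * inner 𝕜 (b i) u) 2 := fun u =>
    (lp.memℓp (b.repr u)).mono' (fun i => by simpa [b.repr_apply_apply] using hle u i)
  have hex : ∀ u : H, ∃ v : H, ∀ i, inner 𝕜 (b i) v = (a i : 𝕜) * inner 𝕜 (b i) u := fun u =>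
    ⟨b.repr.symm ⟨_, hmem u⟩, fun i => by
      rw [← b.repr_apply_apply, LinearIsometryEquiv.apply_symm_apply]⟩
  choose f hf using hex
  let T₀ : H →ₗ[𝕜] H :=
    { toFun := f
      map_add' := fun u v => b.ext_inner fun i => by simp only [hf, inner_add_right, mul_add]
      map_smul' := fun c u => b.ext_inner fun i => by
        simp only [hf, inner_smul_right, RingHom.id_apply]
        ring }
  refine ⟨T₀.mkContinuous 1 fun u => ?_, hf⟩
  rw [one_mul]
  refine (sq_le_sq₀ (norm_nonneg _) (norm_nonneg _)).1 ?_
  refine hasSum_le (fun i => ?_) (b.hasSum_norm_sq _) (b.hasSum_norm_sq _)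
  change ‖(inner 𝕜 (b i) (f u) : 𝕜)‖ ^ 2 ≤ _
  rw [hf]
  exact pow_le_pow_left₀ (norm_nonneg _) (hle u i) 2

/-- Dominated convergence in Parseval's sum, with $|\langle b_i,v\rangle|^2$ as the dominating
series. It serves both for strong continuity and for the domain of the generator. -/
theorem HilbertBasis.tendsto_zero_of_multipliers (b : HilbertBasis ι 𝕜 H) {α : Type*} {l : Filter α}
    {w : α → H} (v : H) (m : α → ι → ℝ)
    (hw : ∀ᶠ t in l, ∀ i, inner 𝕜 (b i) (w t) = (m t i : 𝕜) * inner 𝕜 (b i) v)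
    (hm : ∀ᶠ t in l, ∀ i, |m t i| ≤ 1) (h0 : ∀ i, Tendsto (fun t => m t i) l (𝓝 0)) :
    Tendsto w l (𝓝 0) := by
  have key : Tendsto (fun t => ∑' i, (m t i) ^ 2 * ‖(inner 𝕜 (b i) v : 𝕜)‖ ^ 2) l
      (𝓝 (∑' i, (0 : ℝ) ^ 2 * ‖(inner 𝕜 (b i) v : 𝕜)‖ ^ 2)) := by
    refine tendsto_tsum_of_dominated_convergence (b.hasSum_norm_sq v).summable
      (fun i => ((h0 i).pow 2).mul_const _) ?_
    filter_upwards [hm] with t ht i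
    rw [Real.norm_of_nonneg (by positivity)]
    refine mul_le_of_le_one_left (by positivity) ?_
    rw [← sq_abs]
    exact pow_le_one₀ (abs_nonneg _) (ht i)
  rw [tendsto_zero_iff_norm_tendsto_zero]
  have h2 : Tendsto (fun t => ‖w t‖ ^ 2) l (𝓝 0) := by
    have h3 : (∑' i, (0 : ℝ) ^ 2 * ‖(inner 𝕜 (b i) v : 𝕜)‖ ^ 2) = 0 := by simp
    rw [h3] at key
    refine key.congr' ?_
    filter_upwards [hw] with t ht
    rw [← (b.hasSum_norm_sq (w t)).tsum_eq]
    refine tsum_congr fun i => ?_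
    rw [ht, norm_mul, RCLike.norm_ofReal, mul_pow, sq_abs]
  simpa using h2.sqrt

namespace C0Semigroup

theorem ext_op {T S : C0Semigroup 𝕜 H} (h : ∀ t u, T.op t u = S.op t u) : T = S := by
  have : T.op = S.op := funext fun t => ContinuousLinearMap.ext (h t)
  cases T
  cases S
  simp_all

/-- The semigroup `T` acts on the coordinates in `b` by `e^{-t lam i}`. -/
def IsDiag (T : C0Semigroup 𝕜 H) (b : HilbertBasis ι 𝕜 H) (lam : ι → ℝ) : Prop :=
  ∀ (t : ℝ≥0) (u : H) i, inner 𝕜 (b i) (T.op t u) = (Real.exp (-(t * lam i)) : ℝ) * inner 𝕜 (b i) u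

theorem exists_isDiag (b : HilbertBasis ι 𝕜 H) (lam : ι → ℝ) (hlam : ∀ i, 0 ≤ lam i) :
    ∃ T : C0Semigroup 𝕜 H, T.IsDiag b lam := by
  have hexp : ∀ (t : ℝ≥0) i, |Real.exp (-(t * lam i))| ≤ 1 := fun t i => by
    rw [abs_of_pos (Real.exp_pos _), Real.exp_le_one_iff, neg_nonpos]
    exact mul_nonneg t.2 (hlam i)
  choose op hop using fun t : ℝ≥0 => b.exists_diagonal_clm _ (hexp t)
  refine ⟨⟨op, ?_, ?_, ?_⟩, hop⟩
  · ext u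
    exact b.ext_inner fun i => by simp [hop]
  · intro s t
    ext u
    refine b.ext_inner fun i => ?_
    simp only [hop, ContinuousLinearMap.comp_apply, ← mul_assoc, ← RCLike.ofReal_mul,
      ← Real.exp_add]
    congr 4
    push_cast
    ring
  · intro u
    rw [continuous_iff_continuousAt]
    intro t₀
    rw [ContinuousAt, ← tendsto_sub_nhds_zero_iff]
    refine b.tendsto_zero_of_multipliers u
      (fun t i => Real.exp (-(t * lam i)) - Real.exp (-(t₀ * lam i)))
      (Eventually.of_forall fun t i => by simp [hop, sub_mul, inner_sub_right])
      (Eventually.of_forall fun t i => ?_)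
      fun i => ?_
    · have h1 := hexp t i
      have h2 := hexp t₀ i
      have h3 := Real.exp_pos (-(t * lam i))
      have h4 := Real.exp_pos (-(t₀ * lam i))
      rw [abs_of_pos ‹_›] at h1 h2
      rw [abs_le]
      constructor <;> linarith
    · rw [tendsto_sub_nhds_zero_iff]
      have : Continuous fun t : ℝ≥0 => Real.exp (-(t * lam i)) := by fun_prop
      exact this.tendsto t₀

theorem tendsto_coe_nhdsGT_zero :
    Tendsto (fun t : ℝ≥0 => (t : ℝ)) (𝓝[>] 0) (𝓝[≠] 0) := by
  refine tendsto_nhdsWithin_of_tendsto_nhds_of_eventually_within _ ?_ ?_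
  · exact (NNReal.continuous_coe.tendsto' 0 0 rfl).mono_left nhdsWithin_le_nhds
  · filter_upwards [self_mem_nhdsWithin] with t ht
    simpa using ne_of_gt ht

theorem tendsto_exp_slope (l : ℝ) :
    Tendsto (fun t : ℝ≥0 => (t : ℝ)⁻¹ * (Real.exp (-(t * l)) - 1)) (𝓝[>] 0) (𝓝 (-l)) := by
  have h : HasDerivAt (fun t : ℝ => Real.exp (-(t * l))) (-l) 0 := by
    have := ((hasDerivAt_id (0 : ℝ)).mul_const l).neg.exp
    simpa using this
  have := (hasDerivAt_iff_tendsto_slope.1 h).comp tendsto_coe_nhdsGT_zero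
  refine this.congr fun t => ?_
  simp [slope_def_field, div_eq_inv_mul]

/-- Convergence of the difference quotients in each coordinate gives one inclusion. In the other,
the bound $0\le(1-e^{-x})/x\le1$ for $x>0$ upgrades coordinatewise convergence to norm convergence.
-/
theorem IsDiag.generator_eq {T : C0Semigroup 𝕜 H} {b : HilbertBasis ι 𝕜 H} {lam : ι → ℝ}
    (hT : T.IsDiag b lam) (hlam : ∀ i, 0 ≤ lam i) : T.generator = diagGraph b fun i => -lam i := by
  have hcoef : ∀ (t : ℝ≥0) (u : H) i, inner 𝕜 (b i) ((((t : ℝ)⁻¹ : ℝ) : 𝕜) • (T.op t u - u)) =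
      (((t : ℝ)⁻¹ * (Real.exp (-(t * lam i)) - 1) : ℝ) : 𝕜) * inner 𝕜 (b i) u := fun t u i => by
    rw [inner_smul_right, inner_sub_right, hT]
    push_cast
    ring
  ext ⟨u, v⟩
  constructor
  · intro h i
    have h1 := ((innerSL 𝕜 (b i)).continuous.tendsto v).comp h
    have h2 : Tendsto (fun t : ℝ≥0 => (((t : ℝ)⁻¹ * (Real.exp (-(t * lam i)) - 1) : ℝ) : 𝕜) *
        inner 𝕜 (b i) u) (𝓝[>] 0) (𝓝 (((-lam i : ℝ) : 𝕜) * inner 𝕜 (b i) u)) :=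
      ((RCLike.continuous_ofReal.tendsto _).comp (tendsto_exp_slope (lam i))).mul_const _
    exact tendsto_nhds_unique (h1.congr fun t => hcoef t u i) h2
  · intro h
    rw [generator, Set.mem_ofPred_eq, ← tendsto_sub_nhds_zero_iff]
    -- The multiplier is relative to `v`, not `u`: with $v_i=-\lambda_iu_i$ the quotient has
    -- coordinate $\frac{1-e^{-t\lambda_i}}{t\lambda_i}v_i$. Where $\lambda_i=0$ both coordinates
    -- vanish, so 0 works.
    refine b.tendsto_zero_of_multipliers v
      (fun t i => if lam i = 0 then 0 else
        -((t : ℝ)⁻¹ * (Real.exp (-(t * lam i)) - 1)) / lam i - 1) ?_ ?_ fun i => ?_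
    · refine Eventually.of_forall fun t i => ?_
      have hi := h i
      rw [inner_sub_right, hcoef]
      simp only at hi ⊢
      split_ifs with h0
      · simp [hi, h0]
      · rw [hi]
        have : (lam i : 𝕜) ≠ 0 := by exact_mod_cast h0
        push_cast
        field_simp
        ring
    · filter_upwards [self_mem_nhdsWithin] with t ht i
      split_ifs with h0
      · simp
      · have ht' : (0 : ℝ) < t := ht
        have hl : 0 < lam i := lt_of_le_of_ne (hlam i) (Ne.symm h0)
        have h1 : 0 < (t : ℝ) * lam i := mul_pos ht' hl
        have h2 := Real.add_one_le_exp (-(t * lam i))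
        have h3 : Real.exp (-(t * lam i)) ≤ 1 := by
          rw [Real.exp_le_one_iff]
          linarith
        have h4 : -((t : ℝ)⁻¹ * (Real.exp (-(t * lam i)) - 1)) / lam i =
            (1 - Real.exp (-(t * lam i))) / (t * lam i) := by
          field_simp
          ring
        have h5 : (1 - Real.exp (-(t * lam i))) / (t * lam i) ≤ 1 := by
          rw [div_le_one h1]
          linarith
        have h6 : 0 ≤ (1 - Real.exp (-(t * lam i))) / (t * lam i) :=
          div_nonneg (by linarith) h1.le
        rw [h4, abs_le]
        constructor <;> linarith
    · split_ifs with h0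
      · exact tendsto_const_nhds
      · have := ((tendsto_exp_slope (lam i)).neg.div_const (lam i)).sub_const 1
        simpa [h0] using this

/-- For $s>t$ the semigroup law turns the difference quotient at $t$ into $T_t$ applied to the one
at $0$. Only the right derivative comes this cheaply, and it suffices for uniqueness. -/
theorem hasDerivWithinAt_inner (T : C0Semigroup 𝕜 H) {u v : H} (h : (u, v) ∈ T.generator) (w : H)
    {t : ℝ} (ht : 0 ≤ t) :
    HasDerivWithinAt (fun s : ℝ => inner 𝕜 w (T.op s.toNNReal u))
      (inner 𝕜 w (T.op t.toNNReal v)) (Set.Ici t) t := by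
  rw [hasDerivWithinAt_iff_tendsto_slope]
  simp only [Set.Ici_sdiff_left]
  have h1 : Tendsto (fun s : ℝ => (s - t).toNNReal) (𝓝[>] t) (𝓝[>] 0) := by
    refine tendsto_nhdsWithin_of_tendsto_nhds_of_eventually_within _ ?_ ?_
    · have : Continuous fun s : ℝ => (s - t).toNNReal := by fun_prop
      exact (this.tendsto' t 0 (by simp)).mono_left nhdsWithin_le_nhds
    · filter_upwards [self_mem_nhdsWithin] with s hs
      simpa using hs
  have hc : Continuous fun x : H => inner 𝕜 w (T.op t.toNNReal x) := by fun_prop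
  have h2 := (hc.tendsto v).comp (Tendsto.comp h h1)
  refine h2.congr' ?_
  filter_upwards [self_mem_nhdsWithin] with s hs
  have hs' : t < s := hs
  have h3 : s.toNNReal = t.toNNReal + (s - t).toNNReal := by
    rw [← Real.toNNReal_add ht (by linarith)]
    congr 1
    ring
  simp only [Function.comp_apply, slope, vsub_eq_sub, h3, T.op_add,
    ContinuousLinearMap.comp_apply, map_smul, inner_smul_right, map_sub, inner_sub_right]
  rw [Real.coe_toNNReal _ (by linarith), RCLike.real_smul_eq_coe_mul]

/-- Each $b_i$ is an eigenvector of the generator, so $e^{s\lambda_i}\langle w,T_sb_i\rangle$ is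
continuous with zero right derivative, hence constant. Expanding in the basis then determines `T`.
-/
theorem isDiag_of_generator_eq {T : C0Semigroup 𝕜 H} {b : HilbertBasis ι 𝕜 H} {lam : ι → ℝ}
    (hT : T.generator = diagGraph b fun i => -lam i) : T.IsDiag b lam := by
  classical
  have hb : ∀ i, (b i, ((-lam i : ℝ) : 𝕜) • b i) ∈ T.generator := fun i => by
    rw [hT]
    intro j
    rw [inner_smul_right, b.inner_basis]
    split_ifs with hij
    · rw [hij]
    · simp
  have key : ∀ i (t : ℝ≥0), T.op t (b i) = ((Real.exp (-(t * lam i)) : ℝ) : 𝕜) • b i := by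
    intro i t
    refine ext_inner_left 𝕜 fun w => ?_
    have hd : ∀ s : ℝ, 0 ≤ s → HasDerivWithinAt (fun s : ℝ =>
        Real.exp (s * lam i) • inner 𝕜 w (T.op s.toNNReal (b i))) 0 (Set.Ici s) s := by
      intro s hs
      have h1 := T.hasDerivWithinAt_inner (hb i) w hs
      have h2 : HasDerivAt (fun s : ℝ => Real.exp (s * lam i)) (Real.exp (s * lam i) * lam i) s := by
        simpa using ((hasDerivAt_id s).mul_const (lam i)).exp
      refine (h2.hasDerivWithinAt.smul h1).congr_deriv ?_
      simp only [map_smul, inner_smul_right, RCLike.real_smul_eq_coe_mul]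
      push_cast
      ring
    have hc : Continuous fun s : ℝ =>
        Real.exp (s * lam i) • inner 𝕜 w (T.op s.toNNReal (b i)) := by
      have := (T.op_continuous (b i)).comp continuous_real_toNNReal
      have h2 : Continuous fun s : ℝ => inner 𝕜 w (T.op s.toNNReal (b i)) :=
        continuous_const.inner this
      have h3 : Continuous fun s : ℝ => Real.exp (s * lam i) := by fun_prop
      exact h3.smul h2
    have h := constant_of_has_deriv_right_zero (a := 0) (b := t) hc.continuousOn
      (fun s hs => hd s hs.1) t ⟨t.2, le_rfl⟩
    simp only [zero_mul, Real.exp_zero, one_smul, Real.toNNReal_zero, T.op_zero,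
      Real.toNNReal_coe, ContinuousLinearMap.id_apply] at h
    rw [inner_smul_right, ← h, RCLike.real_smul_eq_coe_mul, ← mul_assoc, ← RCLike.ofReal_mul,
      ← Real.exp_add]
    simp
  intro t u i
  have h1 := (b.hasSum_repr u).mapL (T.op t)
  simp only [b.repr_apply_apply] at h1
  have h2 := h1.mapL (innerSL 𝕜 (b i))
  have h3 : ∀ j, innerSL 𝕜 (b i) (T.op t (inner 𝕜 (b j) u • b j)) =
      if j = i then ((Real.exp (-(t * lam i)) : ℝ) : 𝕜) * inner 𝕜 (b i) u else 0 := fun j => by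
    simp only [map_smul, key, innerSL_apply_apply, smul_eq_mul, b.inner_basis]
    by_cases hij : j = i
    · subst hij; simp [mul_comm]
    · simp [hij, Ne.symm hij]
  simp only [h3] at h2
  exact h2.unique (hasSum_ite_eq i _)

theorem existsUnique_generator_eq (b : HilbertBasis ι 𝕜 H) (lam : ι → ℝ) (hlam : ∀ i, 0 ≤ lam i) :
    ∃! T : C0Semigroup 𝕜 H, T.generator = diagGraph b fun i => -lam i := by
  obtain ⟨T, hT⟩ := exists_isDiag b lam hlam
  refine ⟨T, hT.generator_eq hlam, fun S hS => ?_⟩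
  have hS' := isDiag_of_generator_eq hS
  exact ext_op fun t u => b.ext_inner fun i => by rw [hT, hS']

theorem IsDiag.injective {T : C0Semigroup 𝕜 H} {b : HilbertBasis ι 𝕜 H} {lam : ι → ℝ}
    (hT : T.IsDiag b lam) (t : ℝ≥0) : Function.Injective (T.op t) := by
  intro u v huv
  refine b.ext_inner fun i => ?_
  have h : (inner 𝕜 (b i) (T.op t u) : 𝕜) = inner 𝕜 (b i) (T.op t v) := by rw [huv]
  rw [hT, hT] at h
  refine mul_left_cancel₀ ?_ h
  exact_mod_cast (Real.exp_pos _).ne'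

theorem IsDiag.denseRange {T : C0Semigroup 𝕜 H} {b : HilbertBasis ι 𝕜 H} {lam : ι → ℝ}
    (hT : T.IsDiag b lam) (t : ℝ≥0) : DenseRange (T.op t) := by
  classical
  have hspan : Submodule.span 𝕜 (Set.range b) ≤ LinearMap.range (T.op t : H →ₗ[𝕜] H) := by
    rw [Submodule.span_le]
    rintro _ ⟨i, rfl⟩
    -- The range contains each basis vector: $b_i=T_t(e^{t\lambda_i}b_i)$.
    refine ⟨((Real.exp (t * lam i) : ℝ) : 𝕜) • b i, b.ext_inner fun j => ?_⟩
    rw [ContinuousLinearMap.coe_coe, hT, inner_smul_right, b.inner_basis]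
    split_ifs with hij
    · rw [hij, mul_one, ← RCLike.ofReal_mul, ← Real.exp_add]
      simp
    · simp
  have hd := (Submodule.dense_iff_topologicalClosure_eq_top.2 b.dense_span)
  exact hd.mono hspan

end C0Semigroup

end Diagonal

/-! ### Factorization of semigroups -/

namespace C0Semigroup

variable {𝕜 H : Type*} [RCLike 𝕜] [NormedAddCommGroup H] [NormedSpace 𝕜 H]
  {P Q R : C0Semigroup 𝕜 H}

theorem mem_exp_of_nonneg (T : C0Semigroup 𝕜 H) {s : ℝ} (hs : 0 ≤ s) (z : H × H) :
    z ∈ T.exp s ↔ z.2 = T.op s.toNNReal z.1 := by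
  rw [exp, if_pos hs, Set.mem_ofPred_eq]

theorem mem_exp_of_nonpos (T : C0Semigroup 𝕜 H) {s : ℝ} (hs : s ≤ 0) (z : H × H) :
    z ∈ T.exp s ↔ z.1 = T.op (-s).toNNReal z.2 := by
  rcases hs.lt_or_eq with h | rfl
  · rw [exp, if_neg (not_le.2 h), Set.mem_ofPred_eq]
  · rw [mem_exp_of_nonneg T le_rfl]
    simp [T.op_zero, eq_comm]

/-- Both orders of the factorization are needed: inversion reverses the order, so negative times use
$P=RQ$ to get $P^{-1}=Q^{-1}R^{-1}$. -/
theorem exp_eq_opComp (hQR : ∀ t u, P.op t u = Q.op t (R.op t u))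
    (hRQ : ∀ t u, P.op t u = R.op t (Q.op t u)) (s : ℝ) :
    P.exp s = opComp (Q.exp s) (R.exp s) := by
  ext ⟨u, v⟩
  rcases le_total 0 s with hs | hs
  · simp [opComp, mem_exp_of_nonneg _ hs, hQR]
  · simp only [opComp, mem_exp_of_nonpos _ hs, hRQ, Set.mem_ofPred_eq]
    simp

theorem exp_eq_opComp_neg_left (hRQ : ∀ t u, P.op t u = R.op t (Q.op t u))
    (hinj : ∀ t, Function.Injective (R.op t)) {s : ℝ} (hs : 0 ≤ s) :
    opComp (R.exp (-s)) (P.exp s) = Q.exp s := by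
  ext ⟨u, v⟩
  simp [opComp, mem_exp_of_nonneg _ hs, mem_exp_of_nonpos _ (neg_nonpos.2 hs), hRQ,
    (hinj _).eq_iff, eq_comm]

theorem exp_eq_opComp_neg_right (hRQ : ∀ t u, P.op t u = R.op t (Q.op t u))
    (hinj : ∀ t, Function.Injective (R.op t)) {s : ℝ} (hs : s ≤ 0) :
    opComp (P.exp s) (R.exp (-s)) = Q.exp s := by
  ext ⟨u, v⟩
  simp [opComp, mem_exp_of_nonpos _ hs, mem_exp_of_nonneg _ (neg_nonneg.2 hs), hRQ,
    (hinj _).eq_iff]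

/-- On its natural domain $QRR^{-1}$ is the bounded operator $Q$ restricted to the dense range of
$R$; the closure of its graph is the graph of $Q$. -/
theorem closure_opComp_eq_exp (hQR : ∀ t u, P.op t u = Q.op t (R.op t u))
    (hd : ∀ t, DenseRange (R.op t)) {s : ℝ} (hs : 0 ≤ s) :
    closure (opComp (P.exp s) (R.exp (-s))) = Q.exp s := by
  have h1 : opComp (P.exp s) (R.exp (-s)) =
      (fun u => (u, Q.op s.toNNReal u)) '' Set.range (R.op s.toNNReal) := by
    ext ⟨u, v⟩
    simp only [opComp, mem_exp_of_nonneg _ hs, mem_exp_of_nonpos _ (neg_nonpos.2 hs), hQR,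
      neg_neg, Set.mem_ofPred_eq, ← Set.range_comp, Set.mem_range, Function.comp_apply,
      Prod.mk.injEq]
    exact ⟨fun ⟨w, h, h'⟩ => ⟨w, h.symm, h'.symm⟩, fun ⟨w, h, h'⟩ => ⟨w, h.symm, h'.symm⟩⟩
  have h2 : Q.exp s = Set.range fun u => (u, Q.op s.toNNReal u) := by
    ext ⟨u, v⟩
    simp [mem_exp_of_nonneg _ hs, eq_comm]
  have hc : Continuous fun u => (u, Q.op s.toNNReal u) := by fun_prop
  rw [h1, h2]
  refine subset_antisymm (closure_minimal (Set.image_subset_range _ _) ?_) ?_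
  · rw [← h2]
    simp only [exp, if_pos hs]
    exact isClosed_eq continuous_snd ((Q.op _).continuous.comp continuous_fst)
  · rw [← Set.image_univ, ← (hd s.toNNReal).closure_eq]
    exact image_closure_subset_closure_image hc

end C0Semigroup

/-! ### Joint diagonalization of symmetric operators -/

section JointBasis

variable {𝕜 H : Type*} [RCLike 𝕜] [NormedAddCommGroup H] [InnerProductSpace 𝕜 H]

/-- The graph `G` is that of a symmetric operator. -/
def IsSymmGraph (𝕜 : Type*) {H : Type*} [RCLike 𝕜] [NormedAddCommGroup H] [InnerProductSpace 𝕜 H]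
    (G : Set (H × H)) : Prop :=
  ∀ z ∈ G, ∀ w ∈ G, inner 𝕜 z.2 w.1 = inner 𝕜 z.1 w.2

theorem IsSymmGraph.closure {G : Set (H × H)} (hG : IsSymmGraph 𝕜 G) :
    IsSymmGraph 𝕜 (closure G) := by
  have h1 : ∀ z ∈ G, ∀ w ∈ _root_.closure G, inner 𝕜 z.2 w.1 = inner 𝕜 z.1 w.2 := fun z hz =>
    closure_minimal (t := {w : H × H | inner 𝕜 z.2 w.1 = inner 𝕜 z.1 w.2}) (hG z hz)
      (isClosed_eq (by fun_prop) (by fun_prop))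
  intro z hz w hw
  exact closure_minimal (t := {z : H × H | inner 𝕜 z.2 w.1 = inner 𝕜 z.1 w.2})
    (fun z hz => h1 z hz w hw) (isClosed_eq (by fun_prop) (by fun_prop)) hz

theorem re_inner_nonpos_of_mem_closure {G : Set (H × H)}
    (hG : ∀ z ∈ G, RCLike.re (inner 𝕜 z.1 z.2 : 𝕜) ≤ 0) :
    ∀ z ∈ closure G, RCLike.re (inner 𝕜 z.1 z.2 : 𝕜) ≤ 0 :=
  closure_minimal (t := {z : H × H | RCLike.re (inner 𝕜 z.1 z.2 : 𝕜) ≤ 0}) hG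
    (isClosed_le (RCLike.continuous_re.comp (by fun_prop)) continuous_const)

/-- The space of joint eigenvectors with eigenvalues `a` of the closures of the graphs `G`. -/
def jointEigenspace {κ : Type*} (G : κ → Submodule 𝕜 (H × H)) (a : κ → ℝ) : Submodule 𝕜 H :=
  ⨅ k, (G k).topologicalClosure.comap (LinearMap.id.prod (((a k : ℝ) : 𝕜) • LinearMap.id))

theorem mem_jointEigenspace {κ : Type*} {G : κ → Submodule 𝕜 (H × H)} {a : κ → ℝ} {u : H} :
    u ∈ jointEigenspace G a ↔ ∀ k, (u, ((a k : ℝ) : 𝕜) • u) ∈ closure (G k : Set (H × H)) := by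
  simp [jointEigenspace, ← Submodule.topologicalClosure_coe]

theorem isClosed_jointEigenspace {κ : Type*} (G : κ → Submodule 𝕜 (H × H)) (a : κ → ℝ) :
    IsClosed (jointEigenspace G a : Set H) := by
  have : (jointEigenspace G a : Set H) =
      ⋂ k, (fun u : H => (u, ((a k : ℝ) : 𝕜) • u)) ⁻¹' closure (G k : Set (H × H)) := by
    ext u
    simp [mem_jointEigenspace]
  rw [this]
  exact isClosed_iInter fun k => isClosed_closure.preimage (by fun_prop)

theorem orthogonalFamily_jointEigenspace {κ : Type*} {G : κ → Submodule 𝕜 (H × H)}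
    (hG : ∀ k, IsSymmGraph 𝕜 (G k : Set (H × H))) :
    OrthogonalFamily 𝕜 (fun a : κ → ℝ => jointEigenspace G a)
      fun a => (jointEigenspace G a).subtypeₗᵢ := by
  refine OrthogonalFamily.of_pairwise fun a c hac => ?_
  rw [Function.onFun, Submodule.isOrtho_iff_inner_eq]
  intro u hu v hv
  obtain ⟨k, hk⟩ := Function.ne_iff.1 hac
  have h := (hG k).closure _ (mem_jointEigenspace.1 hu k) _ (mem_jointEigenspace.1 hv k)
  simp only [inner_smul_left, inner_smul_right, RCLike.conj_ofReal] at h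
  by_contra h0
  exact hk (by exact_mod_cast mul_right_cancel₀ h0 h)

/-- Essential self-adjointness from a total set of joint eigenvectors. Eigenspaces of the closures
are closed, hence have Hilbert bases, and are mutually orthogonal by symmetry; no finite
multiplicity is needed. The set `A` carries a relation between the eigenvalues, known on the
original eigenvectors, over to the basis. -/
theorem exists_joint_hilbertBasis.{u, v, w} {𝕜 : Type u} {H : Type v} [RCLike 𝕜]
    [NormedAddCommGroup H] [InnerProductSpace 𝕜 H] [CompleteSpace H] {κ : Type w} (G : κ → Submodule 𝕜 (H × H))
    (hsymm : ∀ k, IsSymmGraph 𝕜 (G k : Set (H × H)))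
    (hneg : ∀ k, ∀ z ∈ G k, RCLike.re (inner 𝕜 z.1 z.2 : 𝕜) ≤ 0)
    (A : Set (κ → ℝ))
    (htotal : ∀ v : H, (∀ a ∈ A, ∀ u : H, (∀ k, (u, ((a k : ℝ) : 𝕜) • u) ∈ G k) →
      inner 𝕜 u v = (0 : 𝕜)) → v = 0) :
    ∃ (ι : Type (max v w)) (b : HilbertBasis ι 𝕜 H) (lam : κ → ι → ℝ), (∀ k i, 0 ≤ lam k i) ∧
      (∀ i, (fun k => -lam k i) ∈ A) ∧
      ∀ k, closure (G k : Set (H × H)) = diagGraph b fun i => -lam k i := by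
  have hcomplete : ∀ a, CompleteSpace (jointEigenspace G a) := fun a =>
    (isClosed_jointEigenspace G a).completeSpace_coe
  choose w e _ using fun a : A => exists_hilbertBasis 𝕜 (jointEigenspace G (a : κ → ℝ))
  have hfam : OrthogonalFamily 𝕜 (fun a : A => jointEigenspace G (a : κ → ℝ))
      fun a => (jointEigenspace G (a : κ → ℝ)).subtypeₗᵢ :=
    (orthogonalFamily_jointEigenspace hsymm).comp Subtype.val_injective
  have hon := hfam.orthonormal_sigma_orthonormal (fun a => (e a).orthonormal)
  have hbot : (Submodule.span 𝕜 (Set.range fun i : Σ a, w a =>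
      (jointEigenspace G (i.1 : κ → ℝ)).subtypeₗᵢ (e i.1 i.2)))ᗮ = ⊥ := by
    rw [Submodule.eq_bot_iff]
    intro v hv
    refine htotal v fun a ha u hu => ?_
    have hmem : u ∈ jointEigenspace G a := mem_jointEigenspace.2 fun k => subset_closure (hu k)
    have h1 := (((e ⟨a, ha⟩).hasSum_repr ⟨u, hmem⟩).mapL (jointEigenspace G a).subtypeL).mapL
      (innerSL 𝕜 v)
    have h2 : ∀ i, innerSL 𝕜 v ((jointEigenspace G a).subtypeL
        ((e ⟨a, ha⟩).repr ⟨u, hmem⟩ i • e ⟨a, ha⟩ i)) = 0 := fun i => by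
      have h3 := hv _ (Submodule.subset_span ⟨⟨⟨a, ha⟩, i⟩, rfl⟩)
      rw [map_smul, map_smul, innerSL_apply_apply]
      exact (congrArg _ (inner_eq_zero_symm.1 h3)).trans (smul_zero _)
    rw [funext h2] at h1
    have h4 := h1.unique hasSum_zero
    rw [innerSL_apply_apply] at h4
    exact inner_eq_zero_symm.1 h4
  let b : HilbertBasis (Σ a, w a) 𝕜 H := HilbertBasis.mkOfOrthogonalEqBot hon hbot
  have hb : ∀ i, b i = (e i.1 i.2 : H) := fun i => by
    simp only [b, HilbertBasis.coe_mkOfOrthogonalEqBot]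
    rfl
  have hmem : ∀ k i, (b i, ((i.1.1 k : ℝ) : 𝕜) • b i) ∈ closure (G k : Set (H × H)) := fun k i => by
    have := mem_jointEigenspace.1 (e i.1 i.2).2 k
    rwa [← hb] at this
  refine ⟨_, b, fun k i => -(i.1.1 k), fun k i => ?_, fun i => ?_, fun k => ?_⟩
  -- For the unit vector $b_i$ the quadratic form equals the eigenvalue, so the latter is
  -- nonpositive.
  · have h1 := re_inner_nonpos_of_mem_closure (hneg k) _ (hmem k i)
    simp only [inner_smul_right, inner_self_eq_norm_sq_to_K, b.orthonormal.1 i] at h1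
    simpa using h1
  · simp
  · simp only [neg_neg]
    refine subset_antisymm (fun z hz i => ?_) fun z hz => ?_
    -- Pairing with the eigenpair of $b_i$ shows that the closure acts diagonally.
    · have h := (hsymm k).closure _ (hmem k i) _ hz
      simp only [inner_smul_left, RCLike.conj_ofReal] at h
      exact h.symm
    -- Conversely, a pair in the maximal diagonal graph is a convergent sum, in $H\times H$, of
    -- multiples of eigenpairs, all lying in the closed subspace.
    · have h1 : HasSum (fun i => inner 𝕜 (b i) z.1 • (b i, ((i.1.1 k : ℝ) : 𝕜) • b i)) z := by
        have h1 := b.hasSum_repr z.1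
        have h2 := b.hasSum_repr z.2
        simp only [b.repr_apply_apply] at h1 h2
        have h3 : ∀ i, inner 𝕜 (b i) z.2 • b i =
            (inner 𝕜 (b i) z.1 : 𝕜) • (((i.1.1 k : ℝ) : 𝕜) • b i) := fun i => by
          rw [hz i, smul_smul, mul_comm]
        rw [funext h3] at h2
        exact h1.prodMk h2
      rw [← Submodule.topologicalClosure_coe]
      refine (Submodule.isClosed_topologicalClosure _).mem_of_tendsto h1
        (Eventually.of_forall fun s => ?_)
      exact sum_mem fun i _ => Submodule.smul_mem _ _ (hmem k i)

end JointBasis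

/-! ### Algebra of the frame -/

/-- The linear vector field `X_{j+1}` on `ℝ^8`. -/
noncomputable def frameL (j : Fin 7) : E8 →L[ℝ] E8 :=
  LinearMap.toContinuousLinearMap
    { toFun := frame j
      map_add' := fun x y => by
        ext i
        fin_cases j <;> fin_cases i <;> simp [frame] <;> ring
      map_smul' := fun c x => by
        ext i
        fin_cases j <;> fin_cases i <;> simp [frame] }

theorem frameL_apply (j : Fin 7) (x : E8) : frameL j x = frame j x := rfl

theorem frameL_frameL (j : Fin 7) (x : E8) : frameL j (frameL j x) = -x := by
  ext i
  fin_cases j <;> fin_cases i <;> simp [frameL_apply, frame]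

theorem inner_frameL_left (j : Fin 7) (x y : E8) : ⟪frameL j x, y⟫ = -⟪x, frameL j y⟫ := by
  fin_cases j <;> simp [frameL_apply, frame, PiLp.inner_apply, Fin.sum_univ_eight] <;> ring

theorem inner_frameL_frameL (j : Fin 7) (x y : E8) : ⟪frameL j x, frameL j y⟫ = ⟪x, y⟫ := by
  rw [inner_frameL_left, frameL_frameL, inner_neg_right, neg_neg]

theorem inner_frameL_self (j : Fin 7) (x : E8) : ⟪frameL j x, x⟫ = 0 := by
  have h := inner_frameL_left j x x
  rw [real_inner_comm] at h
  rw [real_inner_comm]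
  linarith

theorem inner_frameL_of_ne {i j : Fin 7} (hij : i ≠ j) (x : E8) :
    ⟪frameL i x, frameL j x⟫ = 0 := by
  revert hij
  fin_cases i <;> fin_cases j <;> intro hij <;> first | exact absurd rfl hij | skip
  all_goals
    simp [frameL_apply, frame, PiLp.inner_apply, Fin.sum_univ_eight]
    try ring

theorem norm_coe_S7 (p : S7) : ‖(p : E8)‖ = 1 := by simp

theorem S7_ne_zero (p : S7) : (p : E8) ≠ 0 := by
  rw [← norm_ne_zero_iff, norm_coe_S7]
  exact one_ne_zero

theorem inner_frameL_coe (p : S7) (i j : Fin 7) :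
    ⟪frameL i p, frameL j p⟫ = if i = j then 1 else 0 := by
  split_ifs with h
  · rw [h, inner_frameL_frameL, real_inner_self_eq_norm_sq, norm_coe_S7, one_pow]
  · exact inner_frameL_of_ne h p

theorem orthonormal_frame (p : S7) :
    Orthonormal ℝ (Fin.cons (p : E8) (fun j => frameL j p) : Fin 8 → E8) := by
  rw [orthonormal_iff_ite]
  intro i j
  refine Fin.cases ?_ (fun i => ?_) i <;> refine Fin.cases ?_ (fun j => ?_) j
  · simp
  · rw [Fin.cons_zero, Fin.cons_succ, real_inner_comm, inner_frameL_self,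
      if_neg (Fin.succ_ne_zero j).symm]
  · rw [Fin.cons_zero, Fin.cons_succ, inner_frameL_self, if_neg (Fin.succ_ne_zero i)]
  · rw [Fin.cons_succ, Fin.cons_succ, inner_frameL_coe]
    simp

theorem eq_sum_frameL (p : S7) (v : E8) :
    v = ⟪(p : E8), v⟫ • (p : E8) + ∑ j, ⟪frameL j p, v⟫ • frameL j p := by
  have hon := orthonormal_frame p
  have hspan := hon.linearIndependent.span_eq_top_of_card_eq_finrank (by simp)
  have h := (OrthonormalBasis.mk hon hspan.ge).sum_repr' v
  rw [Fin.sum_univ_succ] at h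
  simp only [OrthonormalBasis.coe_mk, Fin.cons_zero, Fin.cons_succ] at h
  exact h.symm

/-! ### Radial extensions and differentials -/

section Radial

variable {F : Type*} [NormedAddCommGroup F]

theorem norm_normalize {x : E8} (hx : x ≠ 0) : ‖‖x‖⁻¹ • x‖ = 1 := by
  simp [norm_smul, hx]

theorem radialExt_of_ne (f : S7 → F) {x : E8} (hx : x ≠ 0) :
    radialExt f x = f ⟨‖x‖⁻¹ • x, by simp [norm_smul, hx]⟩ :=
  dif_neg hx

theorem radialExt_coe (f : S7 → F) (p : S7) : radialExt f p = f p := by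
  rw [radialExt_of_ne f (S7_ne_zero p)]
  congr 1
  ext1
  simp

theorem radialExt_comp_coe (G : E8 → F) {x : E8} (hx : x ≠ 0) :
    radialExt (fun q : S7 => G q) x = G (‖x‖⁻¹ • x) :=
  radialExt_of_ne _ hx

variable [NormedSpace ℝ F]

theorem contDiffAt_normalize {x : E8} (hx : x ≠ 0) :
    ContDiffAt ℝ ∞ (fun x : E8 => ‖x‖⁻¹ • x) x :=
  ((contDiffAt_norm ℝ hx).inv (norm_ne_zero_iff.2 hx)).smul contDiffAt_id

theorem fderiv_normalize_of_inner_eq_zero (p : S7) {v : E8} (hv : ⟪(p : E8), v⟫ = 0) :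
    fderiv ℝ (fun x : E8 => ‖x‖⁻¹ • x) p v = v := by
  have h0 := S7_ne_zero p
  have h1 : HasFDerivAt (fun x : E8 => ‖x‖) (fderiv ℝ (fun x : E8 => ‖x‖) p) p :=
    ((contDiffAt_norm ℝ h0).differentiableAt (n := 1) one_ne_zero).hasFDerivAt
  have h2 : fderiv ℝ (fun x : E8 => ‖x‖) p v = 0 := by
    -- The norm has zero derivative in tangent directions: differentiate $\|x\|^2$ in two ways.
    have h3 := h1.mul h1
    have h4 : HasFDerivAt (fun x : E8 => ‖x‖ * ‖x‖) (2 • innerSL ℝ (p : E8)) p := by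
      have := (hasStrictFDerivAt_norm_sq (p : E8)).hasFDerivAt
      simpa only [pow_two] using this
    have h5 := congrArg (fun L => L v) (h3.unique h4)
    simp [hv] at h5
    linarith
  have h3 := ((hasDerivAt_inv (norm_ne_zero_iff.2 h0)).comp_hasFDerivAt _ h1).smul
    (hasFDerivAt_id (p : E8))
  have h4 := congrArg (fun L => L v) h3.fderiv
  simp [h2] at h4
  exact h4

/-- The radial extension of $G|_{S^7}$ is $G$ after $x\mapsto x/\|x\|$, whose differential at `p`
fixes tangent vectors. Thus any extension may be used to differentiate, and the calculus rules of
$\mathbb R^8$ carry over. -/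
theorem sphereD_comp_coe {G : E8 → F} {p : S7} (hG : DifferentiableAt ℝ G p) {v : E8}
    (hv : ⟪(p : E8), v⟫ = 0) : sphereD (fun q : S7 => G q) p v = fderiv ℝ G p v := by
  have h0 := S7_ne_zero p
  have h1 : radialExt (fun q : S7 => G q) =ᶠ[𝓝 (p : E8)] G ∘ fun x : E8 => ‖x‖⁻¹ • x := by
    filter_upwards [isOpen_ne.mem_nhds h0] with x hx
    exact radialExt_comp_coe G hx
  have hp : ‖(p : E8)‖⁻¹ • (p : E8) = p := by simp
  rw [sphereD, h1.fderiv_eq, fderiv_comp _ (by rwa [hp])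
    ((contDiffAt_normalize h0).differentiableAt (by simp))]
  rw [ContinuousLinearMap.comp_apply, fderiv_normalize_of_inner_eq_zero p hv, hp]

theorem contDiffAt_radialExt {f : S7 → F} (hf : ContMDiff (𝓡 7) 𝓘(ℝ, F) ∞ f) {x : E8}
    (hx : x ≠ 0) : ContDiffAt ℝ ∞ (radialExt f) x := by
  let U : TopologicalSpace.Opens E8 := ⟨{x | x ≠ 0}, isOpen_ne⟩
  have h1 : ContMDiff 𝓘(ℝ, E8) 𝓘(ℝ, E8) ∞ (fun y : U => ‖(y : E8)‖⁻¹ • (y : E8)) := fun y =>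
    (contMDiffAt_subtype_iff (U := U)
      (f := fun x : E8 => ‖x‖⁻¹ • x)).2 (contDiffAt_normalize y.2).contMDiffAt
  have h2 := h1.codRestrict_sphere (n := 7) (fun y => by simpa using norm_normalize y.2)
  have h3 := hf.comp h2
  have h4 : (fun y : U => radialExt f y) = f ∘ Set.codRestrict
      (fun y : U => ‖(y : E8)‖⁻¹ • (y : E8)) (sphere 0 1)
      (fun y => by simpa using norm_normalize y.2) := by
    ext y
    exact radialExt_of_ne f y.2
  rw [← h4] at h3
  exact ((contMDiffAt_subtype_iff (U := U) (x := ⟨x, hx⟩)).1 (h3 ⟨x, hx⟩)).contDiffAt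

theorem contMDiff_comp_coe {G : E8 → F} (hG : ∀ p : S7, ContDiffAt ℝ ∞ G p) :
    ContMDiff (𝓡 7) 𝓘(ℝ, F) ∞ fun p : S7 => G p := fun p =>
  (hG p).contMDiffAt.comp p (contMDiff_coe_sphere p)

end Radial

/-! ### The fields of the frame as derivations -/

/-- The function `X_{j+1} f`. -/
noncomputable def frameDeriv (j : Fin 7) (f : S7 → ℝ) (p : S7) : ℝ := sphereD f p (frameL j p)

/-- Smooth real functions on the sphere. -/
def SmoothS7 (f : S7 → ℝ) : Prop := ContMDiff (𝓡 7) 𝓘(ℝ, ℝ) ∞ f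

namespace SmoothS7

variable {f g : S7 → ℝ}

theorem contDiffAt (hf : SmoothS7 f) (p : S7) : ContDiffAt ℝ ∞ (radialExt f) p :=
  contDiffAt_radialExt hf (S7_ne_zero p)

theorem differentiableAt (hf : SmoothS7 f) (p : S7) : DifferentiableAt ℝ (radialExt f) p :=
  (hf.contDiffAt p).differentiableAt (by simp)

theorem continuous (hf : SmoothS7 f) : Continuous f := ContMDiff.continuous hf

theorem add (hf : SmoothS7 f) (hg : SmoothS7 g) : SmoothS7 fun p => f p + g p :=
  ContMDiff.add hf hg

theorem mul (hf : SmoothS7 f) (hg : SmoothS7 g) : SmoothS7 fun p => f p * g p :=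
  ContMDiff.mul hf hg

theorem const (c : ℝ) : SmoothS7 fun _ => c := contMDiff_const

theorem const_mul (c : ℝ) (hf : SmoothS7 f) : SmoothS7 fun p => c * f p := (const c).mul hf

theorem sum {ι : Type*} {s : Finset ι} {f : ι → S7 → ℝ} (hf : ∀ i ∈ s, SmoothS7 (f i)) :
    SmoothS7 fun p => ∑ i ∈ s, f i p :=
  contMDiff_finsetSum hf

theorem frameDeriv (hf : SmoothS7 f) (j : Fin 7) : SmoothS7 (frameDeriv j f) := by
  refine contMDiff_comp_coe (G := fun x => fderiv ℝ (radialExt f) x (frameL j x)) fun p => ?_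
  exact ((hf.contDiffAt p).fderiv_right (m := ∞) (by simp)).clm_apply
    (frameL j).contDiff.contDiffAt

end SmoothS7

theorem smoothS7_comp_coe {G : E8 → ℝ} (hG : ∀ p : S7, ContDiffAt ℝ ∞ G p) :
    SmoothS7 fun p => G p :=
  contMDiff_comp_coe hG

theorem inner_coe_frameL (j : Fin 7) (p : S7) : ⟪(p : E8), frameL j p⟫ = 0 := by
  rw [real_inner_comm, inner_frameL_self]

theorem frameDeriv_comp_coe {G : E8 → ℝ} {p : S7} (hG : DifferentiableAt ℝ G p) (j : Fin 7) :
    frameDeriv j (fun q : S7 => G q) p = fderiv ℝ G p (frameL j p) :=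
  sphereD_comp_coe hG (inner_coe_frameL j p)

theorem frameDeriv_add {f g : S7 → ℝ} (hf : SmoothS7 f) (hg : SmoothS7 g) (j : Fin 7) :
    frameDeriv j (fun p => f p + g p) = fun p => frameDeriv j f p + frameDeriv j g p := by
  ext p
  have h : (fun p => f p + g p) = fun p : S7 => radialExt f p + radialExt g p := by
    simp only [radialExt_coe]
  rw [h, frameDeriv_comp_coe (G := fun x => radialExt f x + radialExt g x)
    ((hf.differentiableAt p).add (hg.differentiableAt p)),
    fderiv_fun_add (hf.differentiableAt p) (hg.differentiableAt p)]
  rfl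

theorem frameDeriv_mul {f g : S7 → ℝ} (hf : SmoothS7 f) (hg : SmoothS7 g) (j : Fin 7) :
    frameDeriv j (fun p => f p * g p) =
      fun p => f p * frameDeriv j g p + g p * frameDeriv j f p := by
  ext p
  have h : (fun p => f p * g p) = fun p : S7 => radialExt f p * radialExt g p := by
    simp only [radialExt_coe]
  rw [h, frameDeriv_comp_coe (G := fun x => radialExt f x * radialExt g x)
    ((hf.differentiableAt p).mul (hg.differentiableAt p)),
    fderiv_fun_mul (hf.differentiableAt p) (hg.differentiableAt p)]
  simp [radialExt_coe, frameDeriv, sphereD]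

theorem frameDeriv_const (c : ℝ) (j : Fin 7) : frameDeriv j (fun _ => c) = fun _ => 0 := by
  ext p
  rw [frameDeriv_comp_coe (G := fun _ => c) (differentiableAt_const c)]
  simp

theorem frameDeriv_const_mul {f : S7 → ℝ} (hf : SmoothS7 f) (c : ℝ) (j : Fin 7) :
    frameDeriv j (fun p => c * f p) = fun p => c * frameDeriv j f p := by
  rw [frameDeriv_mul (SmoothS7.const c) hf, frameDeriv_const]
  simp

/-! ### Divergence in the frame -/

theorem volForm_frame (p : S7) : volForm p (fun i => frame i p) = 1 := by
  have h : (Matrix.of fun i j : Fin 7 => ⟪frame j p, frame i p⟫) = 1 := by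
    ext i j
    rw [Matrix.of_apply, ← frameL_apply, ← frameL_apply, inner_frameL_coe, Matrix.one_apply]
    simp only [eq_comm]
  rw [volForm, h, Matrix.det_one]

theorem volForm_update (p : S7) (i : Fin 7) (w : E8) :
    volForm p (Function.update (fun i => frame i p) i w) = ⟪frameL i p, w⟫ := by
  have h : (Matrix.of fun k j : Fin 7 =>
      ⟪frame j p, Function.update (fun i => frame i p) i w k⟫) =
      (1 : Matrix (Fin 7) (Fin 7) ℝ).updateRow i fun j => ⟪frame j p, w⟫ := by
    ext k j
    rw [Matrix.of_apply, Matrix.updateRow_apply]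
    split_ifs with hk
    · rw [hk, Function.update_self]
    · rw [Function.update_of_ne hk, ← frameL_apply, ← frameL_apply, inner_frameL_coe,
        Matrix.one_apply]
      simp only [eq_comm]
  rw [volForm, h, ← Matrix.cramer_transpose_apply, Matrix.transpose_one, Matrix.cramer_one]
  rfl

theorem exists_continuousMultilinearMap_det (n : Type*) [Fintype n] [DecidableEq n] :
    ∃ D : ContinuousMultilinearMap ℝ (fun _ : n => n → ℝ) ℝ, ∀ m, D m = Matrix.det (Matrix.of m) :=
  ⟨{ toMultilinearMap := (Matrix.detRowAlternating (n := n) (R := ℝ)).toMultilinearMap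
     cont := by
      change Continuous fun M : Matrix n n ℝ => M.det
      exact continuous_id.matrix_det }, fun _ => rfl⟩

/-- At `p` the matrix is the identity, where the derivative of the determinant is the trace, and
each diagonal term is $\langle X_jp,X_jv\rangle=\langle p,v\rangle=0$. -/
theorem sphereD_volForm_frame (p : S7) {v : E8} (hv : ⟪(p : E8), v⟫ = 0) :
    sphereD (fun q : S7 => volForm q (fun i => frame i p)) p v = 0 := by
  obtain ⟨D, hD⟩ := exists_continuousMultilinearMap_det (Fin 7)
  let r : Fin 7 → E8 →L[ℝ] (Fin 7 → ℝ) := fun j =>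
    ContinuousLinearMap.pi fun i => (innerSL ℝ (frameL i p)).comp (frameL j)
  have hG : (fun q : S7 => volForm q (fun i => frame i p)) =
      fun q : S7 => D fun j => r j (q : E8) := by
    ext q
    -- Transposing puts the frame vectors at `q`, the only varying entries, into the rows of the
    -- multilinear map.
    rw [hD, ← Matrix.det_transpose, volForm]
    congr 1
    ext i j
    simp [r, real_inner_comm, frameL_apply]
  have h := HasFDerivAt.multilinear_comp (f := D) (fun j => (r j).hasFDerivAt (x := (p : E8)))
  rw [hG, sphereD_comp_coe (G := fun x => D fun j => r j x) h.differentiableAt hv, h.fderiv]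
  simp only [_root_.sum_apply, ContinuousLinearMap.comp_apply,
    ContinuousMultilinearMap.toContinuousLinearMap_apply, hD]
  refine Finset.sum_eq_zero fun j _ => ?_
  have h1 : (Matrix.of (Function.update (fun k => r k (p : E8)) j (r j v))) =
      (1 : Matrix (Fin 7) (Fin 7) ℝ).updateRow j (r j v) := by
    ext k i
    rw [Matrix.of_apply, Matrix.updateRow_apply]
    split_ifs with hk
    · rw [hk, Function.update_self]
    · rw [Function.update_of_ne hk, Matrix.one_apply]
      simp [r, inner_frameL_coe, eq_comm]
  rw [h1, ← Matrix.cramer_transpose_apply, Matrix.transpose_one, Matrix.cramer_one]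
  simp [r, inner_frameL_frameL, hv]

/-- The frame fields are divergence free: skewness gives $\langle X_ip,X_jX_ip\rangle=0$, so only
the derivatives of the coefficients survive. -/
theorem divergence_sum_smul_frame {g : Fin 7 → S7 → ℝ} (hg : ∀ j, SmoothS7 (g j)) (p : S7) :
    divergence (fun q => ∑ j, g j q • frameL j q) p = ∑ j, frameDeriv j (g j) p := by
  have hd : ∀ j, DifferentiableAt ℝ (fun x => radialExt (g j) x • frameL j x) p := fun j =>
    ((hg j).differentiableAt p).smul (frameL j).differentiableAt
  have hY : (fun q : S7 => ∑ j, g j q • frameL j (q : E8)) =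
      fun q : S7 => ∑ j, radialExt (g j) q • frameL j (q : E8) := by
    simp only [radialExt_coe]
  have hD : ∀ i, sphereD (fun q : S7 => ∑ j, g j q • frameL j (q : E8)) p (frameL i p) =
      ∑ j, (g j p • frameL j (frameL i p) + frameDeriv i (g j) p • frameL j p) := fun i => by
    rw [hY, sphereD_comp_coe (G := fun x => ∑ j, radialExt (g j) x • frameL j x)
      (DifferentiableAt.fun_sum fun j _ => hd j) (inner_coe_frameL i p),
      fderiv_fun_sum fun j _ => hd j, _root_.sum_apply]
    refine Finset.sum_congr rfl fun j _ => ?_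
    rw [fderiv_fun_smul ((hg j).differentiableAt p) (frameL j).differentiableAt]
    simp [radialExt_coe, frameDeriv, sphereD]
  have htan : ⟪(p : E8), ∑ j, g j p • frameL j p⟫ = 0 := by
    simp [inner_sum, inner_smul_right, inner_coe_frameL]
  rw [divergence, volForm_frame, div_one, lieDerivVol, sphereD_volForm_frame p htan, zero_add]
  refine Finset.sum_congr rfl fun i _ => ?_
  rw [volForm_update, ← frameL_apply i p, hD, inner_sum, Finset.sum_eq_single i]
  · have h1 : ⟪frameL i p, frameL i (frameL i p)⟫ = 0 := by
      rw [real_inner_comm, inner_frameL_self]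
    rw [inner_add_right, inner_smul_right, inner_smul_right, h1, inner_frameL_coe]
    simp
  · intro j _ hji
    have h1 : ⟪frameL i p, frameL j (frameL i p)⟫ = 0 := by
      rw [real_inner_comm, inner_frameL_self]
    simp [inner_add_right, inner_smul_right, inner_frameL_coe, h1, Ne.symm hji]
  · simp

/-! ### The operators as sums of squares -/

/-- The operator `∑ c_j X_{j+1}^2`. -/
noncomputable def sumSq (c : Fin 7 → ℝ) (f : S7 → ℝ) (p : S7) : ℝ :=
  ∑ j, c j * frameDeriv j (frameDeriv j f) p

/-- The weights `c` serve as the 0/1 indicator of the frame vectors that span `D`, so that one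
formula covers both gradients. -/
theorem gradAlong_eq (D : S7 → Submodule ℝ E8) (f : S7 → ℝ) (p : S7) (c : Fin 7 → ℝ)
    (hmem : ∀ j, c j ≠ 0 → frameL j p ∈ D p)
    (hD : ∀ v ∈ D p, v = ∑ j, (c j * ⟪frameL j p, v⟫) • frameL j p) :
    gradAlong D f p = ∑ j, (c j * frameDeriv j f p) • frameL j p := by
  have hw : ∑ j, (c j * frameDeriv j f p) • frameL j p ∈ D p := by
    refine sum_mem fun j _ => ?_
    by_cases h : c j = 0
    · simp [h]
    · exact Submodule.smul_mem _ _ (hmem j h)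
  have h : (InnerProductSpace.toDual ℝ (D p)).symm ((sphereD f p).comp (D p).subtypeL) =
      ⟨_, hw⟩ := by
    rw [LinearIsometryEquiv.symm_apply_eq]
    ext ⟨v, hv⟩
    simp only [ContinuousLinearMap.comp_apply, Submodule.subtypeL_apply,
      InnerProductSpace.toDual_apply_apply, Submodule.coe_inner, sum_inner, inner_smul_left]
    conv_lhs => rw [hD v hv]
    simp [frameDeriv]
    exact Finset.sum_congr rfl fun j _ => by ring
  rw [gradAlong, h]

theorem mem_tangentS7 {p : S7} {v : E8} : v ∈ tangentS7 p ↔ ⟪(p : E8), v⟫ = 0 :=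
  Submodule.mem_orthogonal_singleton_iff_inner_right

theorem mem_contactDist {p : S7} {v : E8} :
    v ∈ contactDist p ↔ ⟪(p : E8), v⟫ = 0 ∧ ⟪frameL 0 p, v⟫ = 0 := by
  rw [contactDist, Submodule.mem_orthogonal]
  constructor
  · intro h
    exact ⟨h _ (Submodule.subset_span (by simp)),
      h _ (Submodule.subset_span (by simp [frameL_apply]))⟩
  · rintro ⟨h1, h2⟩ u hu
    obtain ⟨a, c, rfl⟩ := Submodule.mem_span_pair.1 hu
    rw [frameL_apply] at h2
    simp [inner_add_left, inner_smul_left, h1, h2]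

theorem laplaceBeltrami_eq_sumSq {f : S7 → ℝ} (hf : SmoothS7 f) :
    laplaceBeltrami f = sumSq (fun _ => 1) f := by
  have h : gradAlong tangentS7 f = fun q => ∑ j, frameDeriv j f q • frameL j q := by
    ext1 q
    rw [gradAlong_eq _ _ _ (fun _ => 1) (fun j _ => mem_tangentS7.2 (inner_coe_frameL j q))]
    · simp
    · intro v hv
      have := eq_sum_frameL q v
      rw [mem_tangentS7.1 hv] at this
      simpa using this
  ext p
  rw [laplaceBeltrami, h, divergence_sum_smul_frame fun j => hf.frameDeriv j]
  simp [sumSq]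

theorem subLaplacian_eq_sumSq {f : S7 → ℝ} (hf : SmoothS7 f) :
    subLaplacian f = sumSq (fun j => if j = 0 then 0 else 1) f := by
  have h : gradAlong contactDist f =
      fun q => ∑ j, ((if j = 0 then 0 else 1) * frameDeriv j f q) • frameL j q := by
    ext1 q
    rw [gradAlong_eq _ _ _ (fun j => if j = 0 then 0 else 1)]
    · intro j hj
      refine mem_contactDist.2 ⟨inner_coe_frameL j q, ?_⟩
      have : (0 : Fin 7) ≠ j := by
        rintro rfl
        simp at hj
      rw [inner_frameL_coe, if_neg this]
    · intro v hv
      obtain ⟨h1, h2⟩ := mem_contactDist.1 hv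
      conv_lhs => rw [eq_sum_frameL q v, h1, zero_smul, zero_add]
      refine Finset.sum_congr rfl fun j _ => ?_
      split_ifs with hj
      · simp [hj, h2]
      · simp
  ext p
  rw [subLaplacian, h, divergence_sum_smul_frame fun j => (hf.frameDeriv j).const_mul _]
  simp only [sumSq, frameDeriv_const_mul (hf.frameDeriv _)]

theorem hopfSq_eq_sumSq (f : S7 → ℝ) : hopfSq f = sumSq (fun j => if j = 0 then 1 else 0) f := by
  ext p
  simp only [sumSq, ite_mul, one_mul, zero_mul, Finset.sum_ite_eq', Finset.mem_univ, if_true]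
  rfl

theorem laplaceBeltrami_eq_add {f : S7 → ℝ} (hf : SmoothS7 f) (p : S7) :
    laplaceBeltrami f p = subLaplacian f p + hopfSq f p := by
  rw [laplaceBeltrami_eq_sumSq hf, subLaplacian_eq_sumSq hf, hopfSq_eq_sumSq, sumSq, sumSq, sumSq,
    ← Finset.sum_add_distrib]
  refine Finset.sum_congr rfl fun j _ => ?_
  split_ifs <;> ring

namespace SmoothS7

theorem sumSq {f : S7 → ℝ} (hf : SmoothS7 f) (c : Fin 7 → ℝ) : SmoothS7 (sumSq c f) :=
  SmoothS7.sum fun j _ => ((hf.frameDeriv j).frameDeriv j).const_mul (c j)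

end SmoothS7

theorem sumSq_add {f g : S7 → ℝ} (hf : SmoothS7 f) (hg : SmoothS7 g) (c : Fin 7 → ℝ) :
    sumSq c (fun p => f p + g p) = fun p => sumSq c f p + sumSq c g p := by
  ext p
  simp only [sumSq, frameDeriv_add hf hg, frameDeriv_add (hf.frameDeriv _) (hg.frameDeriv _),
    mul_add, Finset.sum_add_distrib]

theorem sumSq_const_mul {f : S7 → ℝ} (hf : SmoothS7 f) (a : ℝ) (c : Fin 7 → ℝ) :
    sumSq c (fun p => a * f p) = fun p => a * sumSq c f p := by
  ext p
  simp only [sumSq, frameDeriv_const_mul hf, frameDeriv_const_mul (hf.frameDeriv _),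
    Finset.mul_sum]
  exact Finset.sum_congr rfl fun j _ => by ring

/-! ### Integration by parts on the sphere -/

open scoped Pointwise in
-- The surface measure of a set is, up to a constant, the volume of the cone over it, and a linear
-- isometry maps cones to cones.
theorem measurePreserving_toSphere {E : Type*} [NormedAddCommGroup E] [NormedSpace ℝ E]
    [MeasurableSpace E] [BorelSpace E] {μ : Measure E} (R : E ≃ₗᵢ[ℝ] E)
    (hR : MeasurePreserving R μ μ) :
    MeasurePreserving (fun p : sphere (0 : E) 1 => (⟨R p, by simp⟩ : sphere (0 : E) 1))
      μ.toSphere μ.toSphere := by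
  have hc : Continuous fun p : sphere (0 : E) 1 => (⟨R p, by simp⟩ : sphere (0 : E) 1) := by
    fun_prop
  refine ⟨hc.measurable, Measure.ext fun s hs => ?_⟩
  rw [Measure.map_apply hc.measurable hs, Measure.toSphere_apply' _ (hc.measurable hs),
    Measure.toSphere_apply' _ hs]
  congr 1
  have h : Set.Ioo (0 : ℝ) 1 • ((↑) '' ((fun p : sphere (0 : E) 1 =>
      (⟨R p, by simp⟩ : sphere (0 : E) 1)) ⁻¹' s) : Set E) =
      R ⁻¹' (Set.Ioo (0 : ℝ) 1 • ((↑) '' s)) := by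
    ext x
    simp only [Set.mem_smul, Set.mem_image, Set.mem_preimage, Subtype.exists, exists_and_right,
      exists_eq_right]
    constructor
    · rintro ⟨r, hr, y, ⟨hy, hys⟩, rfl⟩
      exact ⟨r, hr, R y, ⟨by simpa using hy, hys⟩, by simp⟩
    · rintro ⟨r, hr, y, ⟨hy, hys⟩, hxy⟩
      refine ⟨r, hr, R.symm y, ⟨by simpa using hy, by simpa using hys⟩, ?_⟩
      rw [← map_smul, hxy, R.symm_apply_apply]
  exact h ▸ hR.measure_preimage_emb R.toHomeomorph.measurableEmbedding _

theorem norm_rotation (j : Fin 7) (t : ℝ) (x : E8) :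
    ‖Real.cos t • x + Real.sin t • frameL j x‖ = ‖x‖ := by
  rw [← sq_eq_sq₀ (norm_nonneg _) (norm_nonneg _), ← real_inner_self_eq_norm_sq,
    ← real_inner_self_eq_norm_sq]
  have h := inner_frameL_self j x
  have h' : ⟪x, frameL j x⟫ = 0 := by rw [real_inner_comm, h]
  simp only [inner_add_left, inner_add_right, inner_smul_left, inner_smul_right, h, h',
    inner_frameL_frameL, conj_trivial]
  linear_combination ⟪x, x⟫ * Real.cos_sq_add_sin_sq t

/-- The flow `cos t + sin t X_{j+1}` of the field `X_{j+1}`. -/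
noncomputable def frameRotation (j : Fin 7) (t : ℝ) : E8 ≃ₗᵢ[ℝ] E8 :=
  LinearIsometry.toLinearIsometryEquiv
    { toLinearMap := (Real.cos t • ContinuousLinearMap.id ℝ E8 + Real.sin t • frameL j).toLinearMap
      norm_map' := fun x => by
        simpa only [ContinuousLinearMap.coe_coe, _root_.add_apply, _root_.smul_apply,
          ContinuousLinearMap.id_apply] using norm_rotation j t x } rfl

theorem frameRotation_apply (j : Fin 7) (t : ℝ) (x : E8) :
    frameRotation j t x = Real.cos t • x + Real.sin t • frameL j x := rfl

/-- The flow of `X_{j+1}` on the sphere. -/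
noncomputable def sphereRotation (j : Fin 7) (t : ℝ) (p : S7) : S7 := ⟨frameRotation j t p, by simp⟩

theorem measurePreserving_sphereRotation (j : Fin 7) (t : ℝ) :
    MeasurePreserving (sphereRotation j t) sphereMeasure sphereMeasure :=
  measurePreserving_toSphere (frameRotation j t) (frameRotation j t).measurePreserving

theorem hasDerivAt_rotation (j : Fin 7) (t : ℝ) (x : E8) :
    HasDerivAt (fun t => frameRotation j t x) (frameL j (frameRotation j t x)) t := by
  simp only [frameRotation_apply, map_add, map_smul, frameL_frameL]
  refine (((Real.hasDerivAt_cos t).smul_const x).add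
    ((Real.hasDerivAt_sin t).smul_const (frameL j x))).congr_deriv ?_
  module

theorem hasDerivAt_comp_sphereRotation {f : S7 → ℝ} (hf : SmoothS7 f) (j : Fin 7) (p : S7)
    (t : ℝ) : HasDerivAt (fun t => f (sphereRotation j t p))
      (frameDeriv j f (sphereRotation j t p)) t := by
  have h := (hf.differentiableAt (sphereRotation j t p)).hasFDerivAt.comp_hasDerivAt t
    (hasDerivAt_rotation j t p)
  refine h.congr_of_eventuallyEq (Eventually.of_forall fun s => ?_)
  exact (radialExt_coe f (sphereRotation j s p)).symm

theorem Continuous.integrable_S7 {F : Type*} [NormedAddCommGroup F] {f : S7 → F}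
    (hf : Continuous f) : Integrable f sphereMeasure :=
  hf.integrable_of_hasCompactSupport (HasCompactSupport.of_compactSpace f)

/-- The flow of the field preserves the measure, so $\int f\circ\varphi_t$ is constant in $t$;
differentiate under the integral at $t=0$. -/
theorem integral_frameDeriv {f : S7 → ℝ} (hf : SmoothS7 f) (j : Fin 7) :
    ∫ p, frameDeriv j f p ∂sphereMeasure = 0 := by
  have hX := (hf.frameDeriv j).continuous
  obtain ⟨C, hC⟩ := (isCompact_range hX).isBounded.exists_norm_le
  have hrot : ∀ t, Continuous (sphereRotation j t) := fun t => by
    unfold sphereRotation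
    fun_prop
  have h := hasDerivAt_integral_of_dominated_loc_of_deriv_le (μ := sphereMeasure)
    (F := fun t p => f (sphereRotation j t p))
    (F' := fun t p => frameDeriv j f (sphereRotation j t p)) (x₀ := 0) (s := Set.univ)
    (bound := fun _ => C) univ_mem
    (Eventually.of_forall fun t => (hf.continuous.comp (hrot t)).aestronglyMeasurable)
    (hf.continuous.comp (hrot 0)).integrable_S7
    (hX.comp (hrot 0)).aestronglyMeasurable
    (Eventually.of_forall fun p t _ => hC _ ⟨_, rfl⟩) (integrable_const C)
    (Eventually.of_forall fun p t _ => hasDerivAt_comp_sphereRotation hf j p t)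
  have hconst : ∀ t, ∫ p, f (sphereRotation j t p) ∂sphereMeasure = ∫ p, f p ∂sphereMeasure :=
    fun t => by
      have hm := measurePreserving_sphereRotation j t
      rw [← integral_map hm.measurable.aemeasurable hf.continuous.aestronglyMeasurable, hm.map_eq]
  simp only [hconst] at h
  have h2 := h.2.unique (hasDerivAt_const (0 : ℝ) _)
  have h0 : ∀ p, sphereRotation j 0 p = p := fun p => by
    ext1
    simp [sphereRotation, frameRotation_apply]
  simpa only [h0] using h2

theorem integral_mul_frameDeriv {f g : S7 → ℝ} (hf : SmoothS7 f) (hg : SmoothS7 g) (j : Fin 7) :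
    ∫ p, f p * frameDeriv j g p ∂sphereMeasure = -∫ p, g p * frameDeriv j f p ∂sphereMeasure := by
  have h := integral_frameDeriv (hf.mul hg) j
  rw [frameDeriv_mul hf hg, integral_add (hf.mul (hg.frameDeriv j)).continuous.integrable_S7
    (hg.mul (hf.frameDeriv j)).continuous.integrable_S7] at h
  linarith

theorem integral_mul_sumSq {f g : S7 → ℝ} (hf : SmoothS7 f) (hg : SmoothS7 g) (c : Fin 7 → ℝ) :
    ∫ p, f p * sumSq c g p ∂sphereMeasure =
      -∑ j, c j * ∫ p, frameDeriv j f p * frameDeriv j g p ∂sphereMeasure := by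
  simp only [sumSq, Finset.mul_sum]
  rw [integral_finsetSum _ fun j _ => (hf.mul (((hg.frameDeriv j).frameDeriv j).const_mul
    (c j))).continuous.integrable_S7, ← Finset.sum_neg_distrib]
  refine Finset.sum_congr rfl fun j _ => ?_
  have h : ∀ p, f p * (c j * frameDeriv j (frameDeriv j g) p) =
      c j * (f p * frameDeriv j (frameDeriv j g) p) := fun p => by ring
  simp only [h]
  rw [integral_const_mul, integral_mul_frameDeriv hf (hg.frameDeriv j), mul_neg]
  simp only [mul_comm]

theorem integral_mul_sumSq_comm {f g : S7 → ℝ} (hf : SmoothS7 f) (hg : SmoothS7 g)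
    (c : Fin 7 → ℝ) :
    ∫ p, f p * sumSq c g p ∂sphereMeasure = ∫ p, sumSq c f p * g p ∂sphereMeasure := by
  simp only [mul_comm (sumSq c f _)]
  rw [integral_mul_sumSq hf hg, integral_mul_sumSq hg hf]
  simp only [mul_comm]

theorem integral_mul_sumSq_self_nonpos {f : S7 → ℝ} (hf : SmoothS7 f) {c : Fin 7 → ℝ}
    (hc : ∀ j, 0 ≤ c j) : ∫ p, f p * sumSq c f p ∂sphereMeasure ≤ 0 := by
  rw [integral_mul_sumSq hf hf, neg_nonpos]
  exact Finset.sum_nonneg fun j _ => mul_nonneg (hc j) (integral_nonneg fun p => mul_self_nonneg _)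

/-! ### The frame acting on polynomials -/

open MvPolynomial in
/-- The coefficients of `X_1, …, X_7` as polynomials. -/
noncomputable def framePoly : Fin 7 → Fin 8 → MvPolynomial (Fin 8) ℝ :=
  ![![-X 1, X 0, -X 3, X 2, -X 5, X 4, -X 7, X 6],
    ![-X 2, X 3, X 0, -X 1, -X 6, X 7, X 4, -X 5],
    ![-X 3, -X 2, X 1, X 0, X 7, X 6, -X 5, -X 4],
    ![-X 4, X 5, X 6, -X 7, X 0, -X 1, -X 2, X 3],
    ![-X 5, -X 4, -X 7, -X 6, X 1, X 0, X 3, X 2],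
    ![-X 6, X 7, -X 4, X 5, X 2, -X 3, X 0, -X 1],
    ![-X 7, -X 6, X 5, X 4, -X 3, -X 2, X 1, X 0]]

/-- The field `X_{j+1}` as a derivation of the polynomial ring. -/
noncomputable def polyDeriv (j : Fin 7) :
    Derivation ℝ (MvPolynomial (Fin 8) ℝ) (MvPolynomial (Fin 8) ℝ) :=
  MvPolynomial.mkDerivation ℝ (framePoly j)

theorem polyDeriv_X (j : Fin 7) (k : Fin 8) : polyDeriv j (MvPolynomial.X k) = framePoly j k :=
  MvPolynomial.mkDerivation_X _ _ _

/-- The restriction of a polynomial to the sphere. -/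
noncomputable def evalS7 (P : MvPolynomial (Fin 8) ℝ) (p : S7) : ℝ :=
  MvPolynomial.eval (fun i => (p : E8) i) P

theorem smoothS7_coord (k : Fin 8) : SmoothS7 fun p : S7 => (p : E8) k :=
  smoothS7_comp_coe (G := fun x => EuclideanSpace.proj (𝕜 := ℝ) k x) fun _ =>
    (EuclideanSpace.proj (𝕜 := ℝ) k).contDiff.contDiffAt

theorem frameDeriv_coord (j : Fin 7) (k : Fin 8) :
    frameDeriv j (fun p : S7 => (p : E8) k) = fun p : S7 => frame j (p : E8) k := by
  ext p
  have h := frameDeriv_comp_coe (G := fun x => EuclideanSpace.proj (𝕜 := ℝ) k x) (p := p)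
    (EuclideanSpace.proj (𝕜 := ℝ) k).differentiableAt j
  rw [ContinuousLinearMap.fderiv] at h
  exact h

theorem eval_framePoly (j : Fin 7) (k : Fin 8) (x : E8) :
    MvPolynomial.eval (fun i => x i) (framePoly j k) = frame j x k := by
  fin_cases j <;> fin_cases k <;> simp [framePoly, frame]

theorem smoothS7_evalS7 (P : MvPolynomial (Fin 8) ℝ) : SmoothS7 (evalS7 P) := by
  induction P using MvPolynomial.induction_on with
  | C a =>
    have h : evalS7 (MvPolynomial.C a) = fun _ => a := by
      ext
      simp [evalS7]
    rw [h]
    exact SmoothS7.const a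
  | add P Q hP hQ =>
    have h : evalS7 (P + Q) = fun p => evalS7 P p + evalS7 Q p := by
      ext
      simp [evalS7]
    rw [h]
    exact hP.add hQ
  | mul_X P k hP =>
    have h : evalS7 (P * MvPolynomial.X k) = fun p => evalS7 P p * (p : E8) k := by
      ext
      simp [evalS7]
    rw [h]
    exact hP.mul (smoothS7_coord k)

theorem frameDeriv_evalS7 (j : Fin 7) (P : MvPolynomial (Fin 8) ℝ) :
    frameDeriv j (evalS7 P) = evalS7 (polyDeriv j P) := by
  induction P using MvPolynomial.induction_on with
  | C a =>
    have h : evalS7 (MvPolynomial.C a) = fun _ => a := by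
      ext
      simp [evalS7]
    rw [h, frameDeriv_const, ← MvPolynomial.algebraMap_eq, Derivation.map_algebraMap]
    ext
    simp [evalS7]
  | add P Q hP hQ =>
    have h : evalS7 (P + Q) = fun p => evalS7 P p + evalS7 Q p := by
      ext
      simp [evalS7]
    rw [h, frameDeriv_add (smoothS7_evalS7 P) (smoothS7_evalS7 Q), hP, hQ]
    ext
    simp [evalS7]
  | mul_X P k hP =>
    have h : evalS7 (P * MvPolynomial.X k) = fun p => evalS7 P p * (p : E8) k := by
      ext
      simp [evalS7]
    rw [h, frameDeriv_mul (smoothS7_evalS7 P) (smoothS7_coord k), hP, frameDeriv_coord]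
    ext
    rw [Derivation.leibniz, polyDeriv_X]
    simp [evalS7, eval_framePoly]

/-- The operator `∑ c_j X_{j+1}^2` on polynomials. -/
noncomputable def polySumSq (c : Fin 7 → ℝ) : End ℝ (MvPolynomial (Fin 8) ℝ) :=
  ∑ j, c j • ((polyDeriv j : End ℝ (MvPolynomial (Fin 8) ℝ)) * (polyDeriv j))

theorem polySumSq_apply (c : Fin 7 → ℝ) (P : MvPolynomial (Fin 8) ℝ) :
    polySumSq c P = ∑ j, c j • polyDeriv j (polyDeriv j P) := by
  simp [polySumSq]

theorem sumSq_evalS7 (c : Fin 7 → ℝ) (P : MvPolynomial (Fin 8) ℝ) :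
    sumSq c (evalS7 P) = evalS7 (polySumSq c P) := by
  ext p
  simp [sumSq, frameDeriv_evalS7, polySumSq_apply, evalS7, MvPolynomial.smul_eval]

/-! ### Commutation of `X_1` with the sub-Laplacian -/

set_option maxHeartbeats 2000000 in
-- The second-order part of $[X_1,\sum_{j\ge2}X_j^2]=\sum_j([X_1,X_j]X_j+X_j[X_1,X_j])$, tested on
-- pairs of coordinates. Single summands do not vanish; only their sum over $j$ does.
theorem sum_polyDeriv_mul_commutator (k l : Fin 8) :
    ∑ j : Fin 6, (framePoly j.succ k * ⁅polyDeriv 0, polyDeriv j.succ⁆ (MvPolynomial.X l) +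
      framePoly j.succ l * ⁅polyDeriv 0, polyDeriv j.succ⁆ (MvPolynomial.X k)) = 0 := by
  simp only [Fin.sum_univ_six, Derivation.commutator_apply, polyDeriv_X]
  fin_cases k <;> fin_cases l <;> simp [framePoly, polyDeriv_X] <;> ring

set_option maxHeartbeats 1000000 in
-- The same commutator applied to the coordinate functions, which controls its first-order part.
theorem sum_polyDeriv_commutator (k : Fin 8) :
    ∑ j : Fin 6, (⁅polyDeriv 0, polyDeriv j.succ⁆ (framePoly j.succ k) +
      polyDeriv j.succ (⁅polyDeriv 0, polyDeriv j.succ⁆ (MvPolynomial.X k))) = 0 := by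
  simp only [Fin.sum_univ_six, Derivation.commutator_apply, polyDeriv_X]
  fin_cases k <;> simp [framePoly, polyDeriv_X]

/-- For fixed `k` the expression is a derivation in `P`, so its values on the variables decide. -/
theorem sum_polyDeriv_mul_commutator_left (k : Fin 8) (P : MvPolynomial (Fin 8) ℝ) :
    ∑ j : Fin 6, (framePoly j.succ k * ⁅polyDeriv 0, polyDeriv j.succ⁆ P +
      polyDeriv j.succ P * ⁅polyDeriv 0, polyDeriv j.succ⁆ (MvPolynomial.X k)) = 0 := by
  have hsum : ∀ (D : Fin 6 → Derivation ℝ (MvPolynomial (Fin 8) ℝ) (MvPolynomial (Fin 8) ℝ)) Q,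
      (∑ j, D j) Q = ∑ j, D j Q := fun D Q => by
    have := congrFun (map_sum Derivation.coeFnAddMonoidHom D Finset.univ) Q
    rwa [Finset.sum_apply] at this
  have h : ∑ j : Fin 6, (framePoly j.succ k • ⁅polyDeriv 0, polyDeriv j.succ⁆ +
      ⁅polyDeriv 0, polyDeriv j.succ⁆ (MvPolynomial.X k) • polyDeriv j.succ) = 0 := by
    refine MvPolynomial.derivation_ext fun l => ?_
    rw [Derivation.zero_apply, ← sum_polyDeriv_mul_commutator k l, hsum]
    refine Finset.sum_congr rfl fun j _ => ?_
    rw [Derivation.add_apply, Derivation.smul_apply, Derivation.smul_apply, polyDeriv_X, smul_eq_mul,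
      smul_eq_mul, mul_comm (framePoly j.succ l)]
  have h2 := congrArg (fun D => D P) h
  simp only [hsum, Derivation.add_apply, Derivation.smul_apply, smul_eq_mul,
    Derivation.zero_apply] at h2
  simpa only [mul_comm (polyDeriv _ P)] using h2

theorem polyDeriv_zero_commutator_sum_sq (P : MvPolynomial (Fin 8) ℝ) :
    ∑ j : Fin 6, (⁅polyDeriv 0, polyDeriv j.succ⁆ (polyDeriv j.succ P) +
      polyDeriv j.succ (⁅polyDeriv 0, polyDeriv j.succ⁆ P)) = 0 := by
  induction P using MvPolynomial.induction_on with
  | C a => simp [← MvPolynomial.algebraMap_eq]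
  | add P Q hP hQ =>
    simp only [map_add]
    rw [← add_zero (0 : MvPolynomial (Fin 8) ℝ)]
    nth_rewrite 1 [← hP]
    rw [← hQ, ← Finset.sum_add_distrib]
    exact Finset.sum_congr rfl fun j _ => by ring
  | mul_X P k hP =>
    have h1 := sum_polyDeriv_mul_commutator_left k P
    have h2 := sum_polyDeriv_commutator k
    -- Product rule for a second-order operator; the factor 2 arises because both orders of
    -- composition contribute the same cross terms.
    have h3 : ∀ j : Fin 6,
        ⁅polyDeriv 0, polyDeriv j.succ⁆ (polyDeriv j.succ (P * MvPolynomial.X k)) +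
          polyDeriv j.succ (⁅polyDeriv 0, polyDeriv j.succ⁆ (P * MvPolynomial.X k)) =
        P * (⁅polyDeriv 0, polyDeriv j.succ⁆ (framePoly j.succ k) +
          polyDeriv j.succ (⁅polyDeriv 0, polyDeriv j.succ⁆ (MvPolynomial.X k))) +
        MvPolynomial.X k * (⁅polyDeriv 0, polyDeriv j.succ⁆ (polyDeriv j.succ P) +
          polyDeriv j.succ (⁅polyDeriv 0, polyDeriv j.succ⁆ P)) +
        2 * (framePoly j.succ k * ⁅polyDeriv 0, polyDeriv j.succ⁆ P +
          polyDeriv j.succ P * ⁅polyDeriv 0, polyDeriv j.succ⁆ (MvPolynomial.X k)) := fun j => by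
      rw [Derivation.leibniz, Derivation.leibniz, polyDeriv_X]
      simp only [smul_eq_mul, map_add, Derivation.leibniz, polyDeriv_X]
      ring
    simp only [h3, Finset.sum_add_distrib, ← Finset.mul_sum] at hP h1 h2 ⊢
    rw [hP, h1, h2]
    simp

theorem commute_polySumSq : Commute (polySumSq fun j => if j = 0 then 1 else 0)
    (polySumSq fun j => if j = 0 then 0 else 1) := by
  have h0 : (polySumSq fun j => if j = 0 then 1 else 0) =
      (polyDeriv 0 : End ℝ (MvPolynomial (Fin 8) ℝ)) * (polyDeriv 0) := by
    simp [polySumSq]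
  have h1 : Commute (polyDeriv 0 : End ℝ (MvPolynomial (Fin 8) ℝ))
      (polySumSq fun j => if j = 0 then 0 else 1) := by
    refine LinearMap.ext fun P => ?_
    rw [Module.End.mul_apply, Module.End.mul_apply, ← sub_eq_zero, ← polyDeriv_zero_commutator_sum_sq P]
    simp only [polySumSq_apply, Fin.sum_univ_succ (n := 6), Fin.succ_ne_zero, if_false, if_true,
      zero_smul, one_smul, zero_add, Derivation.coeFn_coe, map_sum, ← Finset.sum_sub_distrib]
    refine Finset.sum_congr rfl fun j _ => ?_
    simp only [Derivation.commutator_apply, map_sub]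
    ring
  rw [h0]
  exact h1.mul_left h1

/-! ### Finite-dimensional invariant spaces of polynomials -/

/-- The polynomials of degree at most one. -/
noncomputable def affinePoly : Submodule ℝ (MvPolynomial (Fin 8) ℝ) :=
  Submodule.span ℝ (insert 1 (Set.range MvPolynomial.X))

theorem one_mem_affinePoly : (1 : MvPolynomial (Fin 8) ℝ) ∈ affinePoly :=
  Submodule.subset_span (Set.mem_insert _ _)

theorem X_mem_affinePoly (k : Fin 8) : (MvPolynomial.X k : MvPolynomial (Fin 8) ℝ) ∈ affinePoly :=
  Submodule.subset_span (Set.mem_insert_of_mem _ ⟨k, rfl⟩)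

theorem affinePoly_pow_fg (n : ℕ) : (affinePoly ^ n).FG :=
  (Submodule.fg_span ((Set.finite_range _).insert _)).pow n

theorem polyDeriv_mem_affinePoly (j : Fin 7) {P : MvPolynomial (Fin 8) ℝ} (hP : P ∈ affinePoly) :
    polyDeriv j P ∈ affinePoly := by
  have h : affinePoly ≤ affinePoly.comap (polyDeriv j : End ℝ (MvPolynomial (Fin 8) ℝ)) := by
    rw [affinePoly, Submodule.span_le]
    rintro _ (rfl | ⟨k, rfl⟩)
    · simp
    · change polyDeriv j (MvPolynomial.X k) ∈ affinePoly
      rw [polyDeriv_X]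
      fin_cases j <;> fin_cases k <;>
        first | exact X_mem_affinePoly _ | exact neg_mem (X_mem_affinePoly _)
  exact h hP

theorem polyDeriv_mem_affinePoly_pow (j : Fin 7) (n : ℕ) {P : MvPolynomial (Fin 8) ℝ}
    (hP : P ∈ affinePoly ^ n) : polyDeriv j P ∈ affinePoly ^ n := by
  induction n generalizing P with
  | zero =>
    rw [pow_zero, Submodule.mem_one] at hP
    obtain ⟨a, rfl⟩ := hP
    simp
  | succ n ih =>
    rw [pow_succ] at hP ⊢
    induction hP using Submodule.mul_induction_on' with
    | mem_mul_mem Q hQ R hR =>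
      rw [Derivation.leibniz, smul_eq_mul, smul_eq_mul, mul_comm R]
      exact add_mem (Submodule.mul_mem_mul hQ (polyDeriv_mem_affinePoly j hR))
        (Submodule.mul_mem_mul (ih hQ) hR)
    | add Q _ R _ hQ hR =>
      rw [map_add]
      exact add_mem hQ hR

theorem polySumSq_mem_affinePoly_pow (c : Fin 7 → ℝ) (n : ℕ) {P : MvPolynomial (Fin 8) ℝ}
    (hP : P ∈ affinePoly ^ n) : polySumSq c P ∈ affinePoly ^ n := by
  rw [polySumSq_apply]
  exact sum_mem fun j _ => Submodule.smul_mem _ _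
    (polyDeriv_mem_affinePoly_pow j n (polyDeriv_mem_affinePoly_pow j n hP))

theorem exists_mem_affinePoly_pow (P : MvPolynomial (Fin 8) ℝ) : ∃ n, P ∈ affinePoly ^ n := by
  have h1 : 1 ≤ affinePoly := Submodule.one_le.2 one_mem_affinePoly
  induction P using MvPolynomial.induction_on with
  | C a => exact ⟨0, by rw [pow_zero, Submodule.mem_one]; exact ⟨a, rfl⟩⟩
  | add P Q hP hQ =>
    obtain ⟨m, hm⟩ := hP
    obtain ⟨n, hn⟩ := hQ
    exact ⟨max m n, add_mem (pow_le_pow_right' h1 (le_max_left m n) hm)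
      (pow_le_pow_right' h1 (le_max_right m n) hn)⟩
  | mul_X P k hP =>
    obtain ⟨n, hn⟩ := hP
    exact ⟨n + 1, by rw [pow_succ]; exact Submodule.mul_mem_mul hn (X_mem_affinePoly k)⟩

/-! ### Joint eigenvectors in invariant spaces -/

section FiniteDimensional

variable {P H : Type*} [AddCommGroup P] [Module ℝ P] [NormedAddCommGroup H] [InnerProductSpace ℝ H]

/-- Restriction to the sphere is not injective on polynomials, so `L` has to descend to the image.
Symmetry gives this: if $\mathrm{ev}\,d=0$, then
$\|\mathrm{ev}\,Ld\|^2=\langle\mathrm{ev}\,d,\mathrm{ev}\,L^2d\rangle=0$. -/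
theorem exists_end_map_of_isSymmetric (ev : P →ₗ[ℝ] H) (L : End ℝ P)
    (hL : ∀ p q, ⟪ev (L p), ev q⟫ = ⟪ev p, ev (L q)⟫) (W : Submodule ℝ P)
    (hW : ∀ p ∈ W, L p ∈ W) :
    ∃ T : End ℝ (W.map ev), ∀ p : W, T (ev.submoduleMap W p) =
      ev.submoduleMap W ⟨L p, hW p p.2⟩ := by
  obtain ⟨s, hs⟩ := (ev.submoduleMap W).exists_rightInverse_of_surjective
    (LinearMap.range_eq_top.2 (ev.submoduleMap_surjective W))
  refine ⟨ev.submoduleMap W ∘ₗ (L.restrict hW) ∘ₗ s, fun p => ?_⟩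
  set p' : W := s (ev.submoduleMap W p) with hp'
  have h1 : ev.submoduleMap W p' = ev.submoduleMap W p :=
    congrArg (fun f => f (ev.submoduleMap W p)) hs
  have h2 : ev ((p' : P) - p) = 0 := by
    rw [map_sub, sub_eq_zero]
    exact congrArg Subtype.val h1
  have h3 : ev (L ((p' : P) - p)) = 0 := by
    rw [← inner_self_eq_zero (𝕜 := ℝ), hL, h2, inner_zero_left]
  rw [map_sub, map_sub, sub_eq_zero] at h3
  exact Subtype.ext h3

theorem map_mem_span_joint_eigenvectors (ev : P →ₗ[ℝ] H) {L₀ L₁ : End ℝ P} (hc : Commute L₀ L₁)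
    (h₀ : ∀ p q, ⟪ev (L₀ p), ev q⟫ = ⟪ev p, ev (L₀ q)⟫)
    (h₁ : ∀ p q, ⟪ev (L₁ p), ev q⟫ = ⟪ev p, ev (L₁ q)⟫) (W : Submodule ℝ P) (hfg : W.FG)
    (hW₀ : ∀ p ∈ W, L₀ p ∈ W) (hW₁ : ∀ p ∈ W, L₁ p ∈ W) {p : P} (hp : p ∈ W) :
    ev p ∈ Submodule.span ℝ
      {v | ∃ (q : P) (α β : ℝ), ev q = v ∧ ev (L₀ q) = α • v ∧ ev (L₁ q) = β • v} := by
  obtain ⟨T₀, hT₀⟩ := exists_end_map_of_isSymmetric ev L₀ h₀ W hW₀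
  obtain ⟨T₁, hT₁⟩ := exists_end_map_of_isSymmetric ev L₁ h₁ W hW₁
  have hfin : FiniteDimensional ℝ (W.map ev) := Module.Finite.iff_fg.2 (hfg.map ev)
  have hsurj := ev.submoduleMap_surjective W
  have hs₀ : T₀.IsSymmetric := fun x y => by
    obtain ⟨x, rfl⟩ := hsurj x
    obtain ⟨y, rfl⟩ := hsurj y
    rw [hT₀, hT₀]
    exact h₀ x y
  have hs₁ : T₁.IsSymmetric := fun x y => by
    obtain ⟨x, rfl⟩ := hsurj x
    obtain ⟨y, rfl⟩ := hsurj y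
    rw [hT₁, hT₁]
    exact h₁ x y
  have hcT : Commute T₀ T₁ := LinearMap.ext fun x => by
    obtain ⟨x, rfl⟩ := hsurj x
    rw [End.mul_apply, End.mul_apply, hT₀, hT₁, hT₀, hT₁]
    congr 2
    exact congrArg (fun f => f (x : P)) hc
  have htop := LinearMap.IsSymmetric.iSup_iSup_eigenspace_inf_eigenspace_eq_top_of_commute
    hs₀ hs₁ hcT
  have hle : (⊤ : Submodule ℝ (W.map ev)) ≤ (Submodule.span ℝ
      {v | ∃ (q : P) (α β : ℝ), ev q = v ∧ ev (L₀ q) = α • v ∧ ev (L₁ q) = β • v}).comap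
      (W.map ev).subtype := by
    rw [← htop]
    refine iSup_le fun α => iSup_le fun β => fun x hx => ?_
    obtain ⟨q, rfl⟩ := hsurj x
    refine Submodule.subset_span ⟨q, α, β, rfl, ?_, ?_⟩
    · have := End.mem_eigenspace_iff.1 hx.1
      rw [hT₀] at this
      exact congrArg Subtype.val this
    · have := End.mem_eigenspace_iff.1 hx.2
      rw [hT₁] at this
      exact congrArg Subtype.val this
  exact hle (Submodule.mem_top (x := ev.submoduleMap W ⟨p, hp⟩))

end FiniteDimensional

/-! ### Density of polynomials in `L^2` -/

/-- Restriction of polynomials to the sphere, with values in continuous functions. -/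
noncomputable def polyToContinuous : MvPolynomial (Fin 8) ℝ →ₐ[ℝ] C(S7, ℝ) :=
  MvPolynomial.aeval fun k => ⟨fun p => (p : E8) k, by fun_prop⟩

theorem polyToContinuous_apply (P : MvPolynomial (Fin 8) ℝ) (p : S7) :
    polyToContinuous P p = evalS7 P p := by
  induction P using MvPolynomial.induction_on with
  | C a => simp [polyToContinuous, evalS7]
  | add P Q hP hQ => simp [evalS7, hP, hQ]
  | mul_X P k hP =>
    rw [map_mul, ContinuousMap.mul_apply, hP]
    simp [polyToContinuous, evalS7]

/-- Stone–Weierstrass: the coordinates separate points. -/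
theorem denseRange_polyToContinuous : DenseRange polyToContinuous := by
  have hsep : (AlgHom.range polyToContinuous).SeparatesPoints := by
    intro p q hpq
    have : ∃ k, (p : E8) k ≠ (q : E8) k := by
      by_contra! h
      exact hpq (Subtype.ext (by ext k; exact h k))
    obtain ⟨k, hk⟩ := this
    refine ⟨_, ⟨polyToContinuous (MvPolynomial.X k), ⟨_, rfl⟩, rfl⟩, ?_⟩
    simpa [polyToContinuous] using hk
  have h := ContinuousMap.subalgebra_topologicalClosure_eq_top_of_separatesPoints _ hsep
  rw [DenseRange, dense_iff_closure_eq]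
  have h2 := congrArg (fun S : Subalgebra ℝ C(S7, ℝ) => (S : Set C(S7, ℝ))) h
  simpa using h2

/-- Restriction of polynomials to the sphere, with values in `L^2`. -/
noncomputable def polyToL2 : MvPolynomial (Fin 8) ℝ →ₗ[ℝ] L2S7 ℝ :=
  (ContinuousMap.toLp (E := ℝ) 2 sphereMeasure ℝ).toLinearMap ∘ₗ polyToContinuous.toLinearMap

theorem coeFn_polyToL2 (P : MvPolynomial (Fin 8) ℝ) :
    polyToL2 P =ᵐ[sphereMeasure] evalS7 P := by
  refine (ContinuousMap.coeFn_toLp (𝕜 := ℝ) sphereMeasure (polyToContinuous P)).trans ?_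
  exact Eventually.of_forall (polyToContinuous_apply P)

theorem denseRange_polyToL2 : DenseRange polyToL2 :=
  (ContinuousMap.toLp_denseRange ℝ sphereMeasure ℝ (by norm_num)).comp
    denseRange_polyToContinuous (ContinuousLinearMap.continuous _)

theorem inner_polyToL2_polySumSq (c : Fin 7 → ℝ) (P Q : MvPolynomial (Fin 8) ℝ) :
    ⟪polyToL2 (polySumSq c P), polyToL2 Q⟫ = ⟪polyToL2 P, polyToL2 (polySumSq c Q)⟫ := by
  have h : ∀ P Q, ⟪polyToL2 P, polyToL2 Q⟫ = ∫ p, evalS7 P p * evalS7 Q p ∂sphereMeasure :=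
    fun P Q => by
      rw [L2.inner_def]
      refine integral_congr_ae ?_
      filter_upwards [coeFn_polyToL2 P, coeFn_polyToL2 Q] with p hP hQ
      rw [hP, hQ, real_inner_eq_re_inner]
      simp [mul_comm]
  rw [h, h, ← sumSq_evalS7, ← sumSq_evalS7]
  exact (integral_mul_sumSq_comm (smoothS7_evalS7 P) (smoothS7_evalS7 Q) c).symm

/-! ### Graphs of the operators on real or complex functions -/

section Scalars

variable {𝕜 : Type*} [RCLike 𝕜]

theorem ContMDiff.smoothS7_re {f : S7 → 𝕜} (hf : ContMDiff (𝓡 7) 𝓘(ℝ, 𝕜) ∞ f) :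
    SmoothS7 fun p => RCLike.re (f p) :=
  (RCLike.reCLM (K := 𝕜)).contDiff.contMDiff.comp hf

theorem ContMDiff.smoothS7_im {f : S7 → 𝕜} (hf : ContMDiff (𝓡 7) 𝓘(ℝ, 𝕜) ∞ f) :
    SmoothS7 fun p => RCLike.im (f p) :=
  (RCLike.imCLM (K := 𝕜)).contDiff.contMDiff.comp hf

theorem SmoothS7.contMDiff_ofReal {f : S7 → ℝ} (hf : SmoothS7 f) :
    ContMDiff (𝓡 7) 𝓘(ℝ, 𝕜) ∞ fun p => (f p : 𝕜) :=
  (RCLike.ofRealCLM (K := 𝕜)).contDiff.contMDiff.comp hf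

theorem smoothGraph_congr {D D' : (S7 → ℝ) → S7 → ℝ}
    (h : ∀ f, SmoothS7 f → D f = D' f) : smoothGraph 𝕜 D = smoothGraph 𝕜 D' := by
  ext z
  have h2 : ∀ f : S7 → 𝕜, ContMDiff (𝓡 7) 𝓘(ℝ, 𝕜) ∞ f →
      extendScalars 𝕜 D f = extendScalars 𝕜 D' f := fun f hf => by
    ext p
    rw [extendScalars, extendScalars, h _ hf.smoothS7_re, h _ hf.smoothS7_im]
  constructor
  · rintro ⟨f, hf, h1, h3⟩
    exact ⟨f, hf, h1, h2 f hf ▸ h3⟩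
  · rintro ⟨f, hf, h1, h3⟩
    exact ⟨f, hf, h1, (h2 f hf).symm ▸ h3⟩

/-- Handles both scalar fields at once: over the reals `RCLike.I` is 0, but then the imaginary part
of `f` is 0 as well. -/
theorem im_I_mul_sumSq_im {f : S7 → 𝕜} (hf : ContMDiff (𝓡 7) 𝓘(ℝ, 𝕜) ∞ f) (c : Fin 7 → ℝ)
    (p : S7) : RCLike.im (RCLike.I : 𝕜) * sumSq c (fun p => RCLike.im (f p)) p =
      sumSq c (fun p => RCLike.im (f p)) p := by
  have h := congrFun (sumSq_const_mul hf.smoothS7_im (RCLike.im (RCLike.I : 𝕜)) c) p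
  rw [← h]
  congr 1
  ext q
  rw [mul_comm]
  exact RCLike.mul_im_I_ax _

theorem re_extendScalars_sumSq (f : S7 → 𝕜) (c : Fin 7 → ℝ) (p : S7) :
    RCLike.re (extendScalars 𝕜 (sumSq c) f p) = sumSq c (fun p => RCLike.re (f p)) p := by
  simp [extendScalars]

theorem im_extendScalars_sumSq {f : S7 → 𝕜} (hf : ContMDiff (𝓡 7) 𝓘(ℝ, 𝕜) ∞ f) (c : Fin 7 → ℝ)
    (p : S7) :
    RCLike.im (extendScalars 𝕜 (sumSq c) f p) = sumSq c (fun p => RCLike.im (f p)) p := by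
  rw [← im_I_mul_sumSq_im hf]
  simp [extendScalars]

theorem extendScalars_sumSq_add {f g : S7 → 𝕜} (hf : ContMDiff (𝓡 7) 𝓘(ℝ, 𝕜) ∞ f)
    (hg : ContMDiff (𝓡 7) 𝓘(ℝ, 𝕜) ∞ g) (c : Fin 7 → ℝ) (p : S7) :
    extendScalars 𝕜 (sumSq c) (f + g) p =
      extendScalars 𝕜 (sumSq c) f p + extendScalars 𝕜 (sumSq c) g p := by
  refine RCLike.ext ?_ ?_
  · simp only [map_add, re_extendScalars_sumSq, Pi.add_apply,
      sumSq_add hf.smoothS7_re hg.smoothS7_re]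
  · simp only [map_add, im_extendScalars_sumSq (hf.add hg), im_extendScalars_sumSq hf,
      im_extendScalars_sumSq hg, Pi.add_apply, sumSq_add hf.smoothS7_im hg.smoothS7_im]

theorem extendScalars_sumSq_smul {f : S7 → 𝕜} (hf : ContMDiff (𝓡 7) 𝓘(ℝ, 𝕜) ∞ f)
    (a : 𝕜) (c : Fin 7 → ℝ) (p : S7) :
    extendScalars 𝕜 (sumSq c) (fun p => a * f p) p = a * extendScalars 𝕜 (sumSq c) f p := by
  have hc : ContMDiff (𝓡 7) 𝓘(ℝ, 𝕜) ∞ fun p => a * f p :=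
    ((ContinuousLinearMap.mul ℝ 𝕜 a).contDiff.contMDiff).comp hf
  have hr := hf.smoothS7_re
  have hi := hf.smoothS7_im
  refine RCLike.ext ?_ ?_
  · simp only [re_extendScalars_sumSq, im_extendScalars_sumSq hf, RCLike.mul_re, sub_eq_add_neg,
      ← neg_mul]
    rw [sumSq_add (hr.const_mul _) (hi.const_mul _), sumSq_const_mul hr, sumSq_const_mul hi]
  · simp only [re_extendScalars_sumSq, im_extendScalars_sumSq hf, im_extendScalars_sumSq hc,
      RCLike.mul_im]
    rw [sumSq_add (hi.const_mul _) (hr.const_mul _), sumSq_const_mul hr, sumSq_const_mul hi]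

/-- The graph of `∑ c_j X_{j+1}^2` with domain `C^∞(S^7)`, as a subspace of `L^2 × L^2`. -/
noncomputable def sumSqGraph (𝕜 : Type*) [RCLike 𝕜] (c : Fin 7 → ℝ) :
    Submodule 𝕜 (L2S7 𝕜 × L2S7 𝕜) where
  carrier := smoothGraph 𝕜 (sumSq c)
  add_mem' := by
    rintro z w ⟨f, hf, h1, h2⟩ ⟨g, hg, h3, h4⟩
    refine ⟨f + g, hf.add hg, (Lp.coeFn_add _ _).trans (h1.add h3),
      (Lp.coeFn_add _ _).trans ((h2.add h4).trans (Eventually.of_forall fun p => ?_))⟩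
    exact (extendScalars_sumSq_add hf hg c p).symm
  zero_mem' := by
    refine ⟨fun _ => 0, contMDiff_const, Lp.coeFn_zero _ _ _,
      (Lp.coeFn_zero _ _ _).trans (Eventually.of_forall fun p => ?_)⟩
    have h := extendScalars_sumSq_smul (contMDiff_const (c := (0 : 𝕜))) (0 : 𝕜) c p
    simpa using h.symm
  smul_mem' := by
    rintro a z ⟨f, hf, h1, h2⟩
    refine ⟨fun p => a * f p, ((ContinuousLinearMap.mul ℝ 𝕜 a).contDiff.contMDiff).comp hf,
      (Lp.coeFn_smul _ _).trans (h1.const_smul a),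
      (Lp.coeFn_smul _ _).trans ((h2.const_smul a).trans (Eventually.of_forall fun p => ?_))⟩
    exact (extendScalars_sumSq_smul hf a c p).symm

theorem re_im_inner_L2S7 {u v : L2S7 𝕜} {f g : S7 → 𝕜} (hu : u =ᵐ[sphereMeasure] f)
    (hv : v =ᵐ[sphereMeasure] g) :
    RCLike.re (inner 𝕜 u v : 𝕜) = ∫ p, (RCLike.re (f p) * RCLike.re (g p) +
      RCLike.im (f p) * RCLike.im (g p)) ∂sphereMeasure ∧
    RCLike.im (inner 𝕜 u v : 𝕜) = ∫ p, (RCLike.re (f p) * RCLike.im (g p) -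
      RCLike.im (f p) * RCLike.re (g p)) ∂sphereMeasure := by
  rw [L2.inner_def, ← integral_re (L2.integrable_inner u v), ← integral_im (L2.integrable_inner u v)]
  constructor <;> refine integral_congr_ae ?_ <;> filter_upwards [hu, hv] with p hp hq
  · rw [hp, hq, RCLike.inner_apply, RCLike.mul_re, RCLike.conj_re, RCLike.conj_im]
    ring
  · rw [hp, hq, RCLike.inner_apply, RCLike.mul_im, RCLike.conj_re, RCLike.conj_im]
    ring

theorem isSymmGraph_sumSqGraph (c : Fin 7 → ℝ) :
    IsSymmGraph 𝕜 (sumSqGraph 𝕜 c : Set (L2S7 𝕜 × L2S7 𝕜)) := by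
  rintro z ⟨f, hf, h1, h2⟩ w ⟨g, hg, h3, h4⟩
  obtain ⟨h5, h6⟩ := re_im_inner_L2S7 h2 h3
  obtain ⟨h7, h8⟩ := re_im_inner_L2S7 h1 h4
  have hfr := hf.smoothS7_re
  have hfi := hf.smoothS7_im
  have hgr := hg.smoothS7_re
  have hgi := hg.smoothS7_im
  have hint : ∀ {a b : S7 → ℝ}, SmoothS7 a → SmoothS7 b →
      Integrable (fun p => a p * b p) sphereMeasure := fun ha hb =>
    (ha.mul hb).continuous.integrable_S7
  simp only [re_extendScalars_sumSq, im_extendScalars_sumSq hf, im_extendScalars_sumSq hg]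
    at h5 h6 h7 h8
  refine RCLike.ext ?_ ?_
  · rw [h5, h7, integral_add (hint (hfr.sumSq c) hgr) (hint (hfi.sumSq c) hgi),
      integral_add (hint hfr (hgr.sumSq c)) (hint hfi (hgi.sumSq c)),
      integral_mul_sumSq_comm hfr hgr, integral_mul_sumSq_comm hfi hgi]
  · rw [h6, h8, integral_sub (hint (hfr.sumSq c) hgi) (hint (hfi.sumSq c) hgr),
      integral_sub (hint hfr (hgi.sumSq c)) (hint hfi (hgr.sumSq c)), integral_mul_sumSq_comm hfr hgi, integral_mul_sumSq_comm hfi hgr]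

theorem re_inner_sumSqGraph_nonpos {c : Fin 7 → ℝ} (hc : ∀ j, 0 ≤ c j) :
    ∀ z ∈ sumSqGraph 𝕜 c, RCLike.re (inner 𝕜 z.1 z.2 : 𝕜) ≤ 0 := by
  rintro z ⟨f, hf, h1, h2⟩
  have h := (re_im_inner_L2S7 h1 h2).1
  have hfr := hf.smoothS7_re
  have hfi := hf.smoothS7_im
  simp only [re_extendScalars_sumSq, im_extendScalars_sumSq hf] at h
  rw [h, integral_add (hfr.mul (hfr.sumSq c)).continuous.integrable_S7
    (hfi.mul (hfi.sumSq c)).continuous.integrable_S7]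
  exact add_nonpos (integral_mul_sumSq_self_nonpos hfr hc) (integral_mul_sumSq_self_nonpos hfi hc)

/-- The inclusion of real `L^2` functions into real or complex ones. -/
noncomputable def ofRealL2 (𝕜 : Type*) [RCLike 𝕜] : L2S7 ℝ →L[ℝ] L2S7 𝕜 :=
  (RCLike.ofRealCLM (K := 𝕜)).compLpL 2 sphereMeasure

theorem coeFn_ofRealL2 (u : L2S7 ℝ) :
    ofRealL2 𝕜 u =ᵐ[sphereMeasure] fun p => ((u p : ℝ) : 𝕜) :=
  (RCLike.ofRealCLM (K := 𝕜)).coeFn_compLpL u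

theorem eq_zero_of_inner_ofRealL2 {v : L2S7 𝕜} (h : ∀ u, inner 𝕜 (ofRealL2 𝕜 u) v = (0 : 𝕜)) :
    v = 0 := by
  have hv : v = ofRealL2 𝕜 ((RCLike.reCLM (K := 𝕜)).compLpL 2 sphereMeasure v) +
      (RCLike.I : 𝕜) • ofRealL2 𝕜 ((RCLike.imCLM (K := 𝕜)).compLpL 2 sphereMeasure v) := by
    ext1
    filter_upwards [Lp.coeFn_add (ofRealL2 𝕜 ((RCLike.reCLM (K := 𝕜)).compLpL 2 sphereMeasure v))
        ((RCLike.I : 𝕜) • ofRealL2 𝕜 ((RCLike.imCLM (K := 𝕜)).compLpL 2 sphereMeasure v)),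
      Lp.coeFn_smul (RCLike.I : 𝕜)
        (ofRealL2 𝕜 ((RCLike.imCLM (K := 𝕜)).compLpL 2 sphereMeasure v)),
      coeFn_ofRealL2 (𝕜 := 𝕜) ((RCLike.reCLM (K := 𝕜)).compLpL 2 sphereMeasure v),
      coeFn_ofRealL2 (𝕜 := 𝕜) ((RCLike.imCLM (K := 𝕜)).compLpL 2 sphereMeasure v),
      (RCLike.reCLM (K := 𝕜)).coeFn_compLpL (p := 2) v,
      (RCLike.imCLM (K := 𝕜)).coeFn_compLpL (p := 2) v] with p h1 h2 h3 h4 h5 h6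
    rw [h1, Pi.add_apply, h2, Pi.smul_apply, h3, h4, h5, h6]
    simp only [RCLike.reCLM_apply, RCLike.imCLM_apply, smul_eq_mul]
    rw [mul_comm, RCLike.re_add_im]
  rw [← inner_self_eq_zero (𝕜 := 𝕜)]
  nth_rewrite 1 [hv]
  rw [inner_add_left, inner_smul_left, h, h, mul_zero, add_zero]

/-- The eigenvalue equation is only required in $L^2$ of the sphere, not in the polynomial ring. -/
theorem ofRealL2_polyToL2_mem_sumSqGraph {c : Fin 7 → ℝ} {P : MvPolynomial (Fin 8) ℝ} {a : ℝ}
    (h : polyToL2 (polySumSq c P) = a • polyToL2 P) :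
    (ofRealL2 𝕜 (polyToL2 P), (a : 𝕜) • ofRealL2 𝕜 (polyToL2 P)) ∈ sumSqGraph 𝕜 c := by
  have hsm := (smoothS7_evalS7 P).contMDiff_ofReal (𝕜 := 𝕜)
  have h1 : ∀ P, ofRealL2 𝕜 (polyToL2 P) =ᵐ[sphereMeasure] fun p => ((evalS7 P p : ℝ) : 𝕜) :=
    fun P => by
      filter_upwards [coeFn_ofRealL2 (𝕜 := 𝕜) (polyToL2 P), coeFn_polyToL2 P] with p h2 h3
      rw [h2, h3]
  refine ⟨_, hsm, h1 P, ?_⟩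
  have h2 : (a : 𝕜) • ofRealL2 𝕜 (polyToL2 P) = ofRealL2 𝕜 (polyToL2 (polySumSq c P)) := by
    rw [h, map_smul]
    ext1
    filter_upwards [Lp.coeFn_smul (a : 𝕜) (ofRealL2 𝕜 (polyToL2 P)),
      Lp.coeFn_smul a (ofRealL2 𝕜 (polyToL2 P))] with p h3 h4
    rw [h3, h4, Pi.smul_apply, Pi.smul_apply, smul_eq_mul, RCLike.real_smul_eq_coe_mul]
  change ⇑((a : 𝕜) • ofRealL2 𝕜 (polyToL2 P)) =ᵐ[sphereMeasure] _
  rw [h2]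
  refine (h1 _).trans (Eventually.of_forall fun p => ?_)
  refine RCLike.ext ?_ ?_
  · simp only [re_extendScalars_sumSq, RCLike.ofReal_re]
    exact (congrFun (sumSq_evalS7 c P) p).symm
  · have h3 : sumSq c (fun _ => 0) p = 0 := by
      simp [sumSq, frameDeriv_const]
    simp only [im_extendScalars_sumSq hsm, RCLike.ofReal_im, h3]

/-- The coefficients of the sub-Laplacian, of `X_1^2` and of the Laplacian as sums of squares. -/
def sumSqCoeff : Fin 3 → Fin 7 → ℝ :=
  ![fun j => if j = 0 then 0 else 1, fun j => if j = 0 then 1 else 0, fun _ => 1]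

theorem sumSqCoeff_nonneg (k : Fin 3) (j : Fin 7) : 0 ≤ sumSqCoeff k j := by
  fin_cases k <;> simp [sumSqCoeff] <;> split_ifs <;> norm_num

theorem polySumSq_sumSqCoeff_two (P : MvPolynomial (Fin 8) ℝ) : polySumSq (sumSqCoeff 2) P =
    polySumSq (sumSqCoeff 0) P + polySumSq (sumSqCoeff 1) P := by
  simp only [polySumSq_apply, ← Finset.sum_add_distrib, ← add_smul]
  refine Finset.sum_congr rfl fun j _ => ?_
  congr 1
  simp [sumSqCoeff]
  split_ifs <;> norm_num

theorem exists_hilbertBasis_sumSq.{u} (𝕜 : Type u) [RCLike 𝕜] :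
    ∃ (ι : Type u) (b : HilbertBasis ι 𝕜 (L2S7 𝕜)) (lam : Fin 3 → ι → ℝ),
      (∀ k i, 0 ≤ lam k i) ∧ (∀ i, lam 2 i = lam 0 i + lam 1 i) ∧
      ∀ k, closure (smoothGraph 𝕜 (sumSq (sumSqCoeff k))) = diagGraph b fun i => -lam k i := by
  obtain ⟨ι, b, lam, h1, h2, h3⟩ := exists_joint_hilbertBasis (fun k => sumSqGraph 𝕜 (sumSqCoeff k))
    (fun k => isSymmGraph_sumSqGraph _)
    (fun k => re_inner_sumSqGraph_nonpos (sumSqCoeff_nonneg k)) {a | a 2 = a 0 + a 1} fun v hv => by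
      refine eq_zero_of_inner_ofRealL2 ?_
      -- The real functions orthogonal to `v` form a closed real subspace; once it contains the
      -- polynomials it is everything.
      let K : Submodule ℝ (L2S7 ℝ) :=
        { carrier := {u | inner 𝕜 (ofRealL2 𝕜 u) v = (0 : 𝕜)}
          add_mem' := fun {u w} hu hw => by
            simp only [Set.mem_ofPred_eq] at hu hw ⊢
            rw [map_add, inner_add_left, hu, hw, add_zero]
          zero_mem' := by simp
          smul_mem' := fun a u hu => by
            simp only [Set.mem_ofPred_eq] at hu ⊢
            rw [map_smul, RCLike.real_smul_eq_coe_smul (K := 𝕜), inner_smul_left, hu, mul_zero] }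
      have hclosed : IsClosed (K : Set (L2S7 ℝ)) :=
        isClosed_eq (((ofRealL2 𝕜).continuous).inner continuous_const) continuous_const
      have hpoly : ∀ P, polyToL2 P ∈ K := fun P => by
        obtain ⟨n, hn⟩ := exists_mem_affinePoly_pow P
        have hspan := map_mem_span_joint_eigenvectors polyToL2 commute_polySumSq
          (inner_polyToL2_polySumSq _) (inner_polyToL2_polySumSq _) _ (affinePoly_pow_fg n)
          (fun Q => polySumSq_mem_affinePoly_pow _ n) (fun Q => polySumSq_mem_affinePoly_pow _ n) hn
        refine Submodule.span_le.2 ?_ hspan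
        rintro _ ⟨Q, α, β, rfl, hα, hβ⟩
        -- The order is swapped: `commute_polySumSq` lists $X_1^2$ first, so `α` belongs to $X_1^2$
        -- and `β` to the sub-Laplacian, which has index 0 here.
        refine hv ![β, α, α + β] (by simp [add_comm]) _ fun k => ?_
        refine ofRealL2_polyToL2_mem_sumSqGraph ?_
        fin_cases k
        · exact hβ
        · exact hα
        · change polyToL2 (polySumSq (sumSqCoeff 2) Q) = (α + β) • _
          rw [polySumSq_sumSqCoeff_two, map_add, add_smul, add_comm]
          exact congrArg₂ _ hα hβ
      intro u
      exact hclosed.closure_subset_iff.2 (Set.range_subset_iff.2 hpoly) (denseRange_polyToL2 u)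
  refine ⟨ι, b, lam, h1, fun i => ?_, h3⟩
  have := h2 i
  simp only [Set.mem_ofPred_eq] at this
  linarith

end Scalars

/-! ### The factorization theorem -/

theorem mainTheorem3 (𝕜 : Type*) [RCLike 𝕜] :
    -- `Δ_{S^7} = Δ_{sR} + X_1^2` on smooth functions
    (∀ f : S7 → ℝ, ContMDiff (𝓡 7) 𝓘(ℝ, ℝ) ∞ f →
      ∀ p : S7, laplaceBeltrami f p = subLaplacian f p + hopfSq f p) ∧
    -- the three heat semigroups exist and are unique
    (∃! P : C0Semigroup 𝕜 (L2S7 𝕜), IsHeatSemigroup laplaceBeltrami P) ∧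
    (∃! Q : C0Semigroup 𝕜 (L2S7 𝕜), IsHeatSemigroup subLaplacian Q) ∧
    (∃! R : C0Semigroup 𝕜 (L2S7 𝕜), IsHeatSemigroup hopfSq R) ∧
    ∀ P Q R : C0Semigroup 𝕜 (L2S7 𝕜), IsHeatSemigroup laplaceBeltrami P →
      IsHeatSemigroup subLaplacian Q → IsHeatSemigroup hopfSq R →
      -- the semigroup of `Δ_{S^7}` is that of `Δ_{sR} + X_1^2`, and it factors
      IsHeatSemigroup (fun f p => subLaplacian f p + hopfSq f p) P ∧
      (∀ t : ℝ≥0, P.op t = (Q.op t).comp (R.op t)) ∧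
      -- the inverses are densely defined (unbounded) operators
      (∀ t : ℝ≥0, Function.Injective (P.op t) ∧ DenseRange (P.op t) ∧
        Function.Injective (Q.op t) ∧ DenseRange (Q.op t) ∧
        Function.Injective (R.op t) ∧ DenseRange (R.op t)) ∧
      -- the factorization for all real times, with equality of domains
      (∀ s : ℝ, P.exp s = opComp (Q.exp s) (R.exp s)) ∧
      -- the rephrasing: up to closure, and exactly on all of `L^2` in the other order
      (∀ s : ℝ, 0 ≤ s → closure (opComp (P.exp s) (R.exp (-s))) = Q.exp s ∧
        opComp (R.exp (-s)) (P.exp s) = Q.exp s) ∧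
      -- the rephrasing for nonpositive times, with equality of domains
      (∀ s : ℝ, s ≤ 0 → opComp (P.exp s) (R.exp (-s)) = Q.exp s) := by
  obtain ⟨ι, b, lam, hlam, hadd, hcl⟩ := exists_hilbertBasis_sumSq 𝕜
  have hsub : closure (smoothGraph 𝕜 subLaplacian) = diagGraph b fun i => -lam 0 i := by
    rw [← hcl, smoothGraph_congr fun f hf => subLaplacian_eq_sumSq hf]
    rfl
  have hhopf : closure (smoothGraph 𝕜 hopfSq) = diagGraph b fun i => -lam 1 i := by
    rw [← hcl, smoothGraph_congr fun f _ => hopfSq_eq_sumSq f]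
    rfl
  have hlap : closure (smoothGraph 𝕜 laplaceBeltrami) = diagGraph b fun i => -lam 2 i := by
    rw [← hcl, smoothGraph_congr fun f hf => laplaceBeltrami_eq_sumSq hf]
    rfl
  refine ⟨fun f hf => laplaceBeltrami_eq_add hf, ?_, ?_, ?_, fun P Q R hP hQ hR => ?_⟩
  · simp only [IsHeatSemigroup, hlap]
    exact C0Semigroup.existsUnique_generator_eq b _ (hlam 2)
  · simp only [IsHeatSemigroup, hsub]
    exact C0Semigroup.existsUnique_generator_eq b _ (hlam 0)
  · simp only [IsHeatSemigroup, hhopf]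
    exact C0Semigroup.existsUnique_generator_eq b _ (hlam 1)
  · have hPd := C0Semigroup.isDiag_of_generator_eq (hP.trans hlap)
    have hQd := C0Semigroup.isDiag_of_generator_eq (hQ.trans hsub)
    have hRd := C0Semigroup.isDiag_of_generator_eq (hR.trans hhopf)
    -- In each coordinate this is $e^{-t(\lambda+\mu)}=e^{-t\lambda}e^{-t\mu}$; the other order
    -- holds because diagonal operators commute.
    have hQR : ∀ t u, P.op t u = Q.op t (R.op t u) := fun t u => b.ext_inner fun i => by
      rw [hPd, hQd, hRd, hadd, ← mul_assoc, ← RCLike.ofReal_mul, ← Real.exp_add]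
      congr 3
      ring
    have hRQ : ∀ t u, P.op t u = R.op t (Q.op t u) := fun t u => b.ext_inner fun i => by
      rw [hQR, hQd, hRd, hRd, hQd, mul_left_comm]
    refine ⟨?_, fun t => ContinuousLinearMap.ext (hQR t),
      fun t => ⟨hPd.injective t, hPd.denseRange t, hQd.injective t, hQd.denseRange t,
        hRd.injective t, hRd.denseRange t⟩,
      C0Semigroup.exp_eq_opComp hQR hRQ,
      fun s hs => ⟨C0Semigroup.closure_opComp_eq_exp hQR hRd.denseRange hs,
        C0Semigroup.exp_eq_opComp_neg_left hRQ hRd.injective hs⟩,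
      fun s hs => C0Semigroup.exp_eq_opComp_neg_right hRQ hRd.injective hs⟩
    rw [IsHeatSemigroup, ← smoothGraph_congr fun f hf => funext (laplaceBeltrami_eq_add hf)]
    exact hP
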